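/- **Conventions.** A graph of groups $\mathcal G$ consists of a connected graph, vertex groups $G_v$, edge groups $G_e$, and injective homomorphisms from each edge group into the vertex groups at the two ends of the edge. Write $\pi_1(\mathcal G)$ for its fundamental group (equivalently, the fundamental group of the geometric realization $G$ of an associated graph of spaces) and $H_1(G)=\pi_1(\mathcal G)^{\mathrm{ab}}$ for the first homology of that realization. A *finite cover* $\mathcal C\to\mathcal B$ of graphs of groups is a map of graphs of groups, with $\mathcal C$ connected, given by a graph map, injective homomorphisms $H_u\to G_v$ ($u$ over $v$) and $H_f\to G_e$ ($f$ over $e$) that commute with the edge maps up to conjugation in the groups $G_v$, such that for every vertex $u$ over $v$ and every edge $e$ at $v$, the edge maps $H_f\to H_u$ of the edges $f$ at $u$ over $e$ are precisely all the elevations of $G_e\to G_v$ to $H_u$, one edge for each elevation (that is, the conjugating elements $\delta_f\in G_v$ induce a bijection $\bigsqcup_f H_u/H_f\to G_v/G_e$, $hH_f\mapsto h\,\delta_f\,G_e$), and such that over every vertex $v$ there are finitely many vertices $u$, each with $[G_v:H_u]<\infty$. For $g\ge 1$ let $$\pi_1(\Sigma_{g,2})=\langle a_1,b_1,\dots,a_g,b_g,c_1,c_2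 \mid [a_1,b_1]\cdots[a_g,b_g]\,c_1c_2\rangle$$ be the fundamental group of the compact, connected, oriented surface $\Sigma_{g,2}$ of genus $g$ with two boundary components; $c_1,c_2$ represent the boundary components with the induced orientation. A *standard branched surface* is a graph of groups $\mathcal B$ with exactly five vertices: three surface vertices $\Sigma,\Theta,\Pi$, whose vertex groups are identified with $\pi_1(\Sigma_{g,2})$ for some genera $g_\Sigma,g_\Theta,g_\Pi\ge 1$, and two cyclic vertices $C_1,C_2$, whose vertex groups are infinite cyclic with a fixed generator (an orientation); there is exactly one edge between each surface vertex and each cyclic vertex, and there are no other edges; every edge map into a cyclic vertex group is an isomorphism; and, for each surface vertex, the edge to $C_1$ identifies the generator of $C_1$ with a conjugate of $c_1$ and the edge to $C_2$ identifies the generator of $C_2$ with a conjugate of $c_2^{-1}$. In other words, $\mathcal B$ is obtained from two oriented circles $C_1,C_2$ and three compact, connected, oriented surfaces of positive genus, each with two boundary components, by gluing so that $\partial[\Sigma]=\partial[\Theta]=\partial[\Pi]=C_1-C_2$. **Proposition.** Let $\mathcal B$ be a standard branched surface. For every finite abelian group $M$ there are a finite cover $\mathcal B_M$ of $\mathcal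 B$ and an integer $r\ge 0$ such that $$H_1(B_M)\cong M\oplus\mathbb Z^r .$$ -/

import Mathlib

universe u

/-- A graph of groups. The underlying graph is a (multi)graph in which every geometric edge
carries a chosen direction: `E v w` is the set of edges directed from `v` to `w`, so a pair
`{e, ē}` of mutually inverse edges in the sense of Serre is represented by one element.
Each edge `e : E v w` has an edge group `EG e` with injective homomorphisms into the vertex
groups at its two ends. The underlying graph is nonempty and connected (as an undirected graph). -/
structure GraphOfGroups where
  V : Type u
  E : V → V → Type u
  nonempty : Nonempty V
  connected : ∀ v w : V, Relation.EqvGen (fun a b => Nonempty (E a b)) v w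
  VG : V → Type u
  EG : ∀ {v w : V}, E v w → Type u
  [groupVG : ∀ v, Group (VG v)]
  [groupEG : ∀ {v w : V} (e : E v w), Group (EG e)]
  /-- the edge map into the vertex group at the initial vertex -/
  φι : ∀ {v w : V} (e : E v w), EG e →* VG v
  /-- the edge map into the vertex group at the terminal vertex -/
  φτ : ∀ {v w : V} (e : E v w), EG e →* VG w
  φι_injective : ∀ {v w : V} (e : E v w), Function.Injective (φι e)
  φτ_injective : ∀ {v w : V} (e : E v w), Function.Injective (φτ e)

namespace GraphOfGroups

attribute [instance] GraphOfGroups.groupVG GraphOfGroups.groupEG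

/-! ### The fundamental group of a graph of groups (following Serre) -/

section FundamentalGroup

variable (𝒢 : GraphOfGroups.{u})

/-- Generators of the path group: elements of the vertex groups, and one stable letter per edge. -/
inductive Gen
  | elt (v : 𝒢.V) (g : 𝒢.VG v)
  | edge {v w : 𝒢.V} (e : 𝒢.E v w)

/-- Defining relations of the path group: the multiplication in the vertex groups, and
`t_e φτ(x) t_e⁻¹ = φι(x)` for `x` in the edge group of `e`. -/
inductive Rel : FreeGroup 𝒢.Gen → Prop
  | mul (v : 𝒢.V) (g h : 𝒢.VG v) :
      Rel (FreeGroup.of (Gen.elt v g) * FreeGroup.of (Gen.elt v h) *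
        (FreeGroup.of (Gen.elt v (g * h)))⁻¹)
  | conj {v w : 𝒢.V} (e : 𝒢.E v w) (x : 𝒢.EG e) :
      Rel (FreeGroup.of (Gen.edge e) * FreeGroup.of (Gen.elt w (𝒢.φτ e x)) *
        (FreeGroup.of (Gen.edge e))⁻¹ * (FreeGroup.of (Gen.elt v (𝒢.φι e x)))⁻¹)

/-- The path group (Serre's `F(𝒢)`): the free product of all vertex groups and of the free group
on the edges, modulo the relations `t_e φτ(x) t_e⁻¹ = φι(x)`. -/
abbrev PathGroup : Type u := PresentedGroup {r : FreeGroup 𝒢.Gen | 𝒢.Rel r}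

/-- The class of an element of a vertex group in the path group. -/
def elt (v : 𝒢.V) (g : 𝒢.VG v) : 𝒢.PathGroup := PresentedGroup.of (Gen.elt v g)

/-- The stable letter of an edge. -/
def letter {v w : 𝒢.V} (e : 𝒢.E v w) : 𝒢.PathGroup := PresentedGroup.of (Gen.edge e)

/-- `𝒢.IsPath v w x`: the element `x` of the path group is represented by a path from `v` to `w`,
i.e. by a word `g₀ t₁ g₁ t₂ ⋯ tₙ gₙ` where `t₁, …, tₙ` are the letters (or inverses of letters) of
the successive edges of an edge path from `v` to `w`, and each `gᵢ` lies in the vertex group of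
the `i`-th vertex of that edge path. -/
inductive IsPath : 𝒢.V → 𝒢.V → 𝒢.PathGroup → Prop
  | elt (v : 𝒢.V) (g : 𝒢.VG v) : IsPath v v (𝒢.elt v g)
  | letter {v w : 𝒢.V} (e : 𝒢.E v w) : IsPath v w (𝒢.letter e)
  | letter_inv {v w : 𝒢.V} (e : 𝒢.E v w) : IsPath w v (𝒢.letter e)⁻¹
  | mul {u v w : 𝒢.V} {x y : 𝒢.PathGroup} (hx : IsPath u v x) (hy : IsPath v w y) :
      IsPath u w (x * y)

variable {𝒢}

theorem elt_mul (v : 𝒢.V) (g h : 𝒢.VG v) : 𝒢.elt v (g * h) = 𝒢.elt v g * 𝒢.elt v h := by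
  have := PresentedGroup.one_of_mem (rels := {r : FreeGroup 𝒢.Gen | 𝒢.Rel r}) (Rel.mul v g h)
  rw [map_mul, map_mul, map_inv, mul_inv_eq_one] at this
  exact this.symm

theorem elt_one (v : 𝒢.V) : 𝒢.elt v 1 = 1 := by
  have := elt_mul v (1 : 𝒢.VG v) 1
  rwa [mul_one, left_eq_mul] at this

theorem elt_inv (v : 𝒢.V) (g : 𝒢.VG v) : 𝒢.elt v g⁻¹ = (𝒢.elt v g)⁻¹ := by
  rw [eq_inv_iff_mul_eq_one, ← elt_mul, inv_mul_cancel, elt_one]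

theorem IsPath.inv {v w : 𝒢.V} {x : 𝒢.PathGroup} (h : 𝒢.IsPath v w x) : 𝒢.IsPath w v x⁻¹ := by
  induction h with
  | elt v g => rw [← elt_inv]; exact .elt v _
  | letter e => exact .letter_inv e
  | letter_inv e => rw [inv_inv]; exact .letter e
  | mul _ _ hx hy => rw [mul_inv_rev]; exact .mul hy hx

variable (𝒢)

/-- The fundamental group of the graph of groups `𝒢` based at the vertex `v₀`: the elements of
the path group represented by closed paths at `v₀`. -/
def π₁ (v₀ : 𝒢.V) : Subgroup 𝒢.PathGroup where
  carrier := {x | 𝒢.IsPath v₀ v₀ x}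
  mul_mem' hx hy := .mul hx hy
  one_mem' := by
    rw [Set.mem_ofPred_eq, ← elt_one v₀]
    exact .elt v₀ 1
  inv_mem' hx := hx.inv

/-- First homology of (the geometric realization of) `𝒢`: the abelianization of its fundamental
group, written additively. -/
abbrev H₁ (v₀ : 𝒢.V) : Type u := Additive (Abelianization (𝒢.π₁ v₀))

end FundamentalGroup

/-! ### Coverings of graphs of groups -/

/-- A covering `𝒞 → ℬ` of graphs of groups. It consists of a (direction preserving) graph map,
injective homomorphisms of vertex and edge groups, and, at either end of each edge `f` of `𝒞`,
an element `δ` of the corresponding vertex group of `ℬ` such that the edge map of `f` is the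
edge map of the image of `f` up to conjugation by `δ`.

The last two conditions say that the edge maps of `𝒞` at a vertex `u` are exactly all the
elevations of the edge maps of `ℬ` at the image `v` of `u`: elevations of `φ_e : G_e → G_v` to
`H_u ≤ G_v` correspond to the `H_u`-orbits on `G_v / φ_e(G_e)`, and these orbits are represented
once each by the edges `f` of `𝒞` at `u` lying over `e`, the orbit of `f` being
`H_u / φ_f(H_f)`. -/
structure Covering (𝒞 ℬ : GraphOfGroups.{u}) where
  onV : 𝒞.V → ℬ.V
  onE : ∀ {u w : 𝒞.V}, 𝒞.E u w → ℬ.E (onV u) (onV w)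
  onVG : ∀ u : 𝒞.V, 𝒞.VG u →* ℬ.VG (onV u)
  onEG : ∀ {u w : 𝒞.V} (f : 𝒞.E u w), 𝒞.EG f →* ℬ.EG (onE f)
  onVG_injective : ∀ u, Function.Injective (onVG u)
  onEG_injective : ∀ {u w : 𝒞.V} (f : 𝒞.E u w), Function.Injective (onEG f)
  δι : ∀ {u w : 𝒞.V}, 𝒞.E u w → ℬ.VG (onV u)
  δτ : ∀ {u w : 𝒞.V}, 𝒞.E u w → ℬ.VG (onV w)
  comm_ι : ∀ {u w : 𝒞.V} (f : 𝒞.E u w) (x : 𝒞.EG f),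
    onVG u (𝒞.φι f x) = δι f * ℬ.φι (onE f) (onEG f x) * (δι f)⁻¹
  comm_τ : ∀ {u w : 𝒞.V} (f : 𝒞.E u w) (x : 𝒞.EG f),
    onVG w (𝒞.φτ f x) = δτ f * ℬ.φτ (onE f) (onEG f x) * (δτ f)⁻¹
  /-- Edges starting at `u`: the map `(f, h φ_f(H_f)) ↦ (e, h δ_f φ_e(G_e))`, where `e` is the
  image of `f`, is (well defined and) bijective. -/
  bijective_ι : ∀ u : 𝒞.V, ∃ Φ : (Σ f : (Σ w, 𝒞.E u w), 𝒞.VG u ⧸ (𝒞.φι f.2).range) →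
      (Σ e : (Σ w, ℬ.E (onV u) w), ℬ.VG (onV u) ⧸ (ℬ.φι e.2).range),
    (∀ (w : 𝒞.V) (f : 𝒞.E u w) (h : 𝒞.VG u),
      Φ ⟨⟨w, f⟩, QuotientGroup.mk h⟩ =
        ⟨⟨onV w, onE f⟩, QuotientGroup.mk (onVG u h * δι f)⟩) ∧ Function.Bijective Φ
  /-- The same for the edges ending at `u`. -/
  bijective_τ : ∀ u : 𝒞.V, ∃ Φ : (Σ f : (Σ w, 𝒞.E w u), 𝒞.VG u ⧸ (𝒞.φτ f.2).range) →
      (Σ e : (Σ w, ℬ.E w (onV u)), ℬ.VG (onV u) ⧸ (ℬ.φτ e.2).range),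
    (∀ (w : 𝒞.V) (f : 𝒞.E w u) (h : 𝒞.VG u),
      Φ ⟨⟨w, f⟩, QuotientGroup.mk h⟩ =
        ⟨⟨onV w, onE f⟩, QuotientGroup.mk (onVG u h * δτ f)⟩) ∧ Function.Bijective Φ

/-- A covering is finite(-sheeted) if the number of sheets `∑_{u ↦ v} [G_v : H_u]` over every
vertex `v` is finite. -/
def Covering.IsFinite {𝒞 ℬ : GraphOfGroups.{u}} (Φ : Covering 𝒞 ℬ) : Prop :=
  (∀ v : ℬ.V, Finite {u : 𝒞.V // Φ.onV u = v}) ∧ ∀ u : 𝒞.V, (Φ.onVG u).range.FiniteIndex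

end GraphOfGroups

/-! ### Surface groups with boundary and standard branched surfaces -/

/-- Generators of the fundamental group of a surface of genus `g` with `n` boundary components. -/
inductive SurfaceGen (g n : ℕ)
  | a (i : Fin g)
  | b (i : Fin g)
  | c (j : Fin n)

/-- The surface relator `[a₁,b₁] ⋯ [a_g,b_g] c₁ ⋯ cₙ`, where `[a,b] = a b a⁻¹ b⁻¹`. -/
def surfaceRelator (g n : ℕ) : FreeGroup (SurfaceGen g n) :=
  (List.ofFn fun i : Fin g =>
      FreeGroup.of (SurfaceGen.a (n := n) i) * FreeGroup.of (SurfaceGen.b (n := n) i) *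
        (FreeGroup.of (SurfaceGen.a (n := n) i))⁻¹ * (FreeGroup.of (SurfaceGen.b (n := n) i))⁻¹).prod *
    (List.ofFn fun j : Fin n => FreeGroup.of (SurfaceGen.c (g := g) j)).prod

/-- The fundamental group `⟨aᵢ, bᵢ, cⱼ | [a₁,b₁] ⋯ [a_g,b_g] c₁ ⋯ cₙ⟩` of the compact, connected,
oriented surface of genus `g` with `n` boundary components. -/
abbrev SurfaceGroup (g n : ℕ) : Type := PresentedGroup {surfaceRelator g n}

/-- The `j`-th boundary loop, with the orientation induced from the surface. -/
def SurfaceGroup.boundary {g n : ℕ} (j : Fin n) : SurfaceGroup g n :=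
  PresentedGroup.of (SurfaceGen.c j)

/-- The data exhibiting a graph of groups `ℬ` as a standard branched surface: three surface
vertices, two cyclic vertices `C₁, C₂`, exactly one edge between each surface vertex and each
cyclic vertex (directed towards the cyclic vertex) and no other edges. -/
structure StandardBranchedSurface (ℬ : GraphOfGroups.{u}) where
  surf : Fin 3 → ℬ.V
  cyc : Fin 2 → ℬ.V
  vertices : Function.Bijective (Sum.elim surf cyc)
  edge : ∀ i j, ℬ.E (surf i) (cyc j)
  edge_unique : ∀ i j (e : ℬ.E (surf i) (cyc j)), e = edge i j
  no_edge_surf : ∀ i i', IsEmpty (ℬ.E (surf i) (surf i'))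
  no_edge_cyc : ∀ j v, IsEmpty (ℬ.E (cyc j) v)
  /-- The cyclic vertices are oriented circles: their groups are identified with `ℤ`. -/
  circle : ∀ j, Multiplicative ℤ ≃* ℬ.VG (cyc j)
  /-- The surface vertices are oriented surfaces of positive genus with two boundary components. -/
  genus : Fin 3 → ℕ
  genus_pos : ∀ i, 1 ≤ genus i
  surface : ∀ i, ℬ.VG (surf i) ≃* SurfaceGroup (genus i) 2
  /-- The edge maps into the cyclic vertex groups are isomorphisms. -/
  φτ_bijective : ∀ i j, Function.Bijective (ℬ.φτ (edge i j))
  /-- The first boundary component of each surface is identified with `C₁`, preserving the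
  orientation ... -/
  attach_zero : ∀ i (x : ℬ.EG (edge i 0)), ℬ.φτ (edge i 0) x = circle 0 (Multiplicative.ofAdd 1) →
    IsConj (surface i (ℬ.φι (edge i 0) x)) (SurfaceGroup.boundary 0)
  /-- ... and the second one with `C₂`, reversing it, so that the fundamental class of each
  surface has boundary `C₁ - C₂`. -/
  attach_one : ∀ i (x : ℬ.EG (edge i 1)), ℬ.φτ (edge i 1) x = circle 1 (Multiplicative.ofAdd 1) →
    IsConj (surface i (ℬ.φι (edge i 1) x)) (SurfaceGroup.boundary 1)⁻¹

/-- `ℬ` is a standard branched surface. -/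
def GraphOfGroups.IsStandardBranchedSurface (ℬ : GraphOfGroups.{u}) : Prop :=
  Nonempty (StandardBranchedSurface ℬ)

/-!
By Mayer–Vietoris, the first homology of a graph of groups is the cokernel of
`⨁ₑ H₁(G_e) → ⨁ᵥ H₁(G_v)` plus a free group, coming from the loops in the underlying graph.

Let `n = |M|`, and consider the `n`-sheeted cyclic cover of each surface given by the character
which is `1` on `a₁` and `0` on the other generators. It has `n` boundary components over each
circle, and its homology is generated by the boundary components and further free classes, with the
single relation that the boundary components sum to zero. Glue `n` copies of each of the three
covers along `n²` copies of each of the two circles, in the pattern of the addition table of `M`: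
the circles correspond to the cells `(x, y)`, and the surfaces to the rows `x`, the columns `y` and
the symbols `x + y`. Up to a free summand, the homology of the result is generated by the cells (a
cell being the difference of the two circles over it), with the relations that the cells of each
row, column and symbol sum to zero.

A torsion class of this quotient is represented by an integral function of the cells which has the
form `F₀(x) + F₁(y) + F₂(x + y)` with real-valued `Fᵢ`. This sum vanishes modulo `ℤ`, so up to
constants `F₀`, `F₁` and `-F₂` are the same homomorphism from `M` to `ℝ/ℤ`. Hence the torsion is the
dual of `M`, which is isomorphic to `M`.
-/

/-! ### Extensions of abelian groups by torsion-free quotients -/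

theorem exists_addEquiv_prod_of_exact {A H F : Type*} [AddCommGroup A] [AddCommGroup H]
    [AddCommGroup F] [IsAddTorsionFree F] {f : A →+ H} {g : H →+ F} [AddGroup.FG g.range]
    (hf : Function.Injective f) (hfg : Function.Exact f g) :
    ∃ r : ℕ, Nonempty (H ≃+ A × (Fin r → ℤ)) := by
  have : IsAddTorsionFree g.range := g.range.subtype_injective.isAddTorsionFree _
  have : Module.IsTorsionFree ℤ g.range := Module.isTorsionFree_int_iff_isAddTorsionFree.mpr ‹_›
  have : Module.Finite ℤ g.range := Module.Finite.iff_addGroup_fg.mpr ‹_›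
  let π : H →ₗ[ℤ] g.range := g.rangeRestrict.toIntLinearMap
  have hπ : Function.Exact f.toIntLinearMap π := fun x ↦
    (Subtype.ext_iff (a1 := g.rangeRestrict x)).trans (hfg x)
  obtain ⟨σ, hσ⟩ := Module.projective_lifting_property π .id g.rangeRestrict_surjective
  let split := (hπ.splitSurjectiveEquiv hf ⟨σ, hσ⟩).1
  let coordinates := (Module.finBasis ℤ g.range).equivFun
  exact ⟨_, ⟨(split.trans ((LinearEquiv.refl ℤ A).prodCongr coordinates)).toAddEquiv⟩⟩

theorem exists_addEquiv_prod_trans {A B C : Type*} [AddGroup A] [AddGroup B] [AddGroup C]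
    (hAB : ∃ r : ℕ, Nonempty (A ≃+ B × (Fin r → ℤ)))
    (hBC : ∃ r : ℕ, Nonempty (B ≃+ C × (Fin r → ℤ))) :
    ∃ r : ℕ, Nonempty (A ≃+ C × (Fin r → ℤ)) := by
  obtain ⟨r, ⟨f⟩⟩ := hAB
  obtain ⟨s, ⟨g⟩⟩ := hBC
  let concat : (Fin s → ℤ) × (Fin r → ℤ) ≃+ (Fin (s + r) → ℤ) :=
    ((LinearEquiv.sumArrowLequivProdArrow (Fin s) (Fin r) ℤ ℤ).symm.trans
      (LinearEquiv.funCongrLeft ℤ ℤ finSumFinEquiv.symm)).toAddEquiv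
  exact ⟨s + r, ⟨f.trans <| (g.prodCongr (.refl _)).trans <|
    AddEquiv.prodAssoc.trans <| (AddEquiv.refl C).prodCongr concat⟩⟩

/-! ### The incidence quotient of a Latin square -/

section Incidence

variable {ι M L : Type*} [Fintype ι] (R : Type*) [CommRing R]

/-- For an incidence structure in which the point `p : L` lies, for every `i : ι`, on exactly one
line of the `i`-th pencil, namely the one labelled by `line i p : M`, the map from functions on
the lines to functions on the points which adds up the values at the lines through a point. -/
def incidenceMap (line : ι → L → M) : (ι → M → R) →ₗ[R] (L → R) where
  toFun F p := ∑ i, F i (line i p)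
  map_add' _ _ := funext fun _ ↦ Finset.sum_add_distrib
  map_smul' _ _ := funext fun _ ↦ (Finset.mul_sum ..).symm

theorem incidenceMap_apply (line : ι → L → M) (F : ι → M → R) (p : L) :
    incidenceMap R line F p = ∑ i, F i (line i p) := rfl

/-- The cokernel of the incidence map; for `R = ℤ` it is the abelian group generated by the points,
with the relation that the points of every line add up to `0`. -/
abbrev IncidenceQuotient (line : ι → L → M) : Type _ := (L → R) ⧸ (incidenceMap R line).range

namespace IncidenceQuotient

/-- The map induced by the inclusion of the integers in the reals. -/
def toReal (line : ι → L → M) : IncidenceQuotient ℤ line →+ IncidenceQuotient ℝ line :=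
  (Submodule.liftQ _
    (((incidenceMap ℝ line).range.mkQ.restrictScalars ℤ) ∘ₗ
      (Int.castAddHom ℝ).toIntLinearMap.compLeft L) <| by
    rintro _ ⟨F, rfl⟩
    refine (Submodule.Quotient.mk_eq_zero _).mpr ⟨fun i m ↦ F i m, funext fun p ↦ ?_⟩
    simp [incidenceMap_apply]).toAddMonoidHom

theorem toReal_mk_eq_zero {line : ι → L → M} {c : L → ℤ} :
    toReal line (Submodule.Quotient.mk c) = 0 ↔
      ∃ F : ι → M → ℝ, ∀ p, (c p : ℝ) = ∑ i, F i (line i p) := by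
  refine (Submodule.Quotient.mk_eq_zero _).trans (exists_congr fun F ↦ ?_)
  exact funext_iff.trans (forall_congr' fun p ↦ eq_comm)

theorem mk_eq_mk_of_coe_eq_zero {line : ι → L → M} {c d : L → ℤ} (F : ι → M → ℝ)
    (hF : ∀ i m, (F i m : UnitAddCircle) = 0)
    (h : ∀ p, (c p - d p : ℝ) = ∑ i, F i (line i p)) :
    (Submodule.Quotient.mk c : IncidenceQuotient ℤ line) = Submodule.Quotient.mk d := by
  choose k hk using fun i m ↦ (AddCircle.coe_eq_zero_iff (1 : ℝ)).mp (hF i m)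
  refine (Submodule.Quotient.eq _).mpr ⟨k, funext fun p ↦ ?_⟩
  have : ((∑ i, k i (line i p) : ℤ) : ℝ) = (c p - d p : ℤ) := by
    push_cast
    simp only [h, ← hk, zsmul_one]
  exact_mod_cast this

variable [DecidableEq L] {line : ι → L → M}

variable (line) in
/-- The class of a point. -/
def point (p : L) : IncidenceQuotient ℤ line := Submodule.Quotient.mk (Pi.single p 1)

theorem mk_eq_sum_smul_point [Fintype L] (c : L → ℤ) :
    (Submodule.Quotient.mk c : IncidenceQuotient ℤ line) = ∑ p, c p • point line p := by
  conv_lhs => rw [pi_eq_sum_univ' c]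
  exact map_sum (Submodule.mkQ _) _ _

theorem hom_ext [Finite L] {A : Type*} [AddCommGroup A] {φ ψ : IncidenceQuotient ℤ line →+ A}
    (h : ∀ p, φ (point line p) = ψ (point line p)) : φ = ψ := by
  have := Fintype.ofFinite L
  ext q
  obtain ⟨c, rfl⟩ := Submodule.Quotient.mk_surjective _ q
  simp only [mk_eq_sum_smul_point, map_sum, map_zsmul, h]

variable [Fintype L] [DecidableEq M]

theorem sum_point_eq_zero (i : ι) (m : M) : ∑ p with line i p = m, point line p = 0 := by
  classical
  have h_line : incidenceMap ℤ line (Pi.single i (Pi.single m 1)) =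
      ∑ p with line i p = m, Pi.single p 1 := by
    ext p
    rw [incidenceMap_apply, Finset.sum_eq_single i (fun k _ hk ↦ by simp [hk]) (by simp)]
    simp [Pi.single_apply, Finset.sum_apply]
  exact (map_sum (Submodule.mkQ _) _ _).symm.trans <|
    (Submodule.Quotient.mk_eq_zero _).mpr ⟨_, h_line⟩

/-- The homomorphism with prescribed values on the points, provided that the values at the points
of every line add up to `0`. -/
def lift {A : Type*} [AddCommGroup A] (ω : L → A)
    (hω : ∀ i m, ∑ p with line i p = m, ω p = 0) : IncidenceQuotient ℤ line →+ A :=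
  (Submodule.liftQ _ (Fintype.linearCombination ℤ ω) <| by
    rintro _ ⟨F, rfl⟩
    rw [LinearMap.mem_ker, Fintype.linearCombination_apply]
    simp only [incidenceMap_apply, Finset.sum_smul]
    rw [Finset.sum_comm]
    refine Finset.sum_eq_zero fun i _ ↦ ?_
    rw [← Finset.sum_fiberwise_of_maps_to fun p hp ↦ Finset.mem_image_of_mem (line i) hp]
    refine Finset.sum_eq_zero fun m _ ↦ ?_
    calc ∑ p with line i p = m, F i (line i p) • ω p
        = ∑ p with line i p = m, F i m • ω p :=
          Finset.sum_congr rfl fun p hp ↦ by rw [(Finset.mem_filter.mp hp).2]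
      _ = 0 := by rw [← Finset.smul_sum, hω, smul_zero]).toAddMonoidHom

@[simp]
theorem lift_point {A : Type*} [AddCommGroup A] (ω : L → A)
    (hω : ∀ i m, ∑ p with line i p = m, ω p = 0) (p : L) : lift ω hω (point line p) = ω p := by
  simp [lift, point, Fintype.linearCombination_apply_single]

end IncidenceQuotient

end Incidence

section Latin

variable {M : Type*} [AddCommGroup M]

/-- The lines of the Latin square of `M`: the point `(x, y)` lies on the line `x` of the first
pencil, on the line `y` of the second one and on the line `x + y` of the third one. -/
def latinLine (i : Fin 3) (p : M × M) : M := ![p.1, p.2, p.1 + p.2] i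

theorem exists_addMonoidHom_of_add_eq_zero {A : Type*} [AddCommGroup A] {F : Fin 3 → M → A}
    (hF : ∀ x y, F 0 x + F 1 y + F 2 (x + y) = 0) :
    ∃ ψ : M →+ A, ∀ z, F 0 z = ψ z + F 0 0 ∧ F 1 z = ψ z + F 1 0 ∧ F 2 z = F 2 0 - ψ z := by
  have h₀ z : F 0 z + F 1 0 + F 2 z = 0 := by simpa using hF z 0
  have h₁ z : F 0 0 + F 1 z + F 2 z = 0 := by simpa using hF 0 z
  have h_zero : F 0 0 + F 1 0 + F 2 0 = 0 := h₀ 0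
  refine ⟨AddMonoidHom.mk' (fun z ↦ F 0 z - F 0 0) fun x y ↦ ?_, fun z ↦ ?_⟩
  · have := hF x y
    grind
  · simp only [AddMonoidHom.mk'_apply]
    grind

theorem incidenceMap_latinLine (R : Type*) [CommRing R] (F : Fin 3 → M → R) (p : M × M) :
    incidenceMap R latinLine F p = F 0 p.1 + F 1 p.2 + F 2 (p.1 + p.2) := by
  simp only [incidenceMap_apply, latinLine, Fin.sum_univ_three, Matrix.cons_val]

theorem coe_intCast_eq_zero (k : ℤ) : ((k : ℝ) : UnitAddCircle) = 0 :=
  (AddCircle.coe_eq_zero_iff 1).mpr ⟨k, zsmul_one _⟩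

/-- The integral `2`-cocycle obtained by lifting a character from the circle to the reals, that is,
the image of the character under the Bockstein map of `0 → ℤ → ℝ → ℝ/ℤ → 0`. -/
noncomputable def characterCocycle (φ : M →+ UnitAddCircle) (p : M × M) : ℤ :=
  ⌊(φ p.1).out + (φ p.2).out - (φ (p.1 + p.2)).out⌋

theorem coe_characterCocycle (φ : M →+ UnitAddCircle) (p : M × M) :
    (characterCocycle φ p : ℝ) = (φ p.1).out + (φ p.2).out - (φ (p.1 + p.2)).out := by
  have h : (((φ p.1).out + (φ p.2).out - (φ (p.1 + p.2)).out : ℝ) : UnitAddCircle) = 0 := by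
    simp only [AddCircle.coe_sub, AddCircle.coe_add, QuotientAddGroup.out_eq', map_add, sub_self]
  obtain ⟨k, hk⟩ := (AddCircle.coe_eq_zero_iff (1 : ℝ)).mp h
  rw [characterCocycle, ← hk, zsmul_one, Int.floor_intCast]

/-- The map from the character group to the incidence quotient of the Latin square given by the
classes of the cocycles `characterCocycle`. -/
noncomputable def characterClass :
    (M →+ UnitAddCircle) →+ IncidenceQuotient ℤ (latinLine (M := M)) :=
  AddMonoidHom.mk' (fun φ ↦ Submodule.Quotient.mk (characterCocycle φ)) fun φ ψ ↦ by
    let u (z : M) : ℝ := ((φ + ψ) z).out - (φ z).out - (ψ z).out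
    have hu (z : M) : (u z : UnitAddCircle) = 0 := by
      simp only [u, AddCircle.coe_sub, QuotientAddGroup.out_eq', AddMonoidHom.add_apply]
      abel
    rw [← Submodule.Quotient.mk_add]
    refine IncidenceQuotient.mk_eq_mk_of_coe_eq_zero ![u, u, -u] ?_ fun p ↦ ?_
    · intro i m
      fin_cases i <;> simp [hu]
    · simp only [Pi.add_apply, Int.cast_add, coe_characterCocycle, Fin.sum_univ_three, latinLine,
        Matrix.cons_val, Pi.neg_apply, u]
      ring

theorem addMonoidHom_real_eq_zero [Finite M] (f : M →+ ℝ) : f = 0 := by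
  ext x
  exact (isOfFinAddOrder_iff_eq_zero (f x)).mp <| f.isOfFinAddOrder (isOfFinAddOrder_of_finite x)

theorem characterClass_injective [Finite M] :
    Function.Injective (characterClass (M := M)) := by
  refine (injective_iff_map_eq_zero _).mpr fun φ hφ ↦ ?_
  obtain ⟨F, hF⟩ := (Submodule.Quotient.mk_eq_zero _).mp hφ
  let G : Fin 3 → M → ℝ := ![fun z ↦ (φ z).out - F 0 z, fun z ↦ (φ z).out - F 1 z,
    fun z ↦ -(φ z).out - F 2 z]
  have hG (x y : M) : G 0 x + G 1 y + G 2 (x + y) = 0 := by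
    have h : F 0 x + F 1 y + F 2 (x + y) = characterCocycle φ (x, y) :=
      (incidenceMap_latinLine ℤ F (x, y)).symm.trans (congrFun hF (x, y))
    rify [coe_characterCocycle] at h
    simp only [G, Matrix.cons_val]
    linear_combination -h
  obtain ⟨ψ, hψ⟩ := exists_addMonoidHom_of_add_eq_zero hG
  rw [addMonoidHom_real_eq_zero ψ] at hψ
  ext x
  have h : (φ x).out = (φ 0).out + (F 0 x - F 0 0) := by
    have := (hψ x).1
    simp only [G, Matrix.cons_val, AddMonoidHom.zero_apply] at this
    linear_combination this
  have := congrArg (fun t : ℝ ↦ (t : UnitAddCircle)) h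
  simpa [QuotientAddGroup.out_eq', coe_intCast_eq_zero] using this

theorem exists_characterClass_eq_mk {c : M × M → ℤ} {F : Fin 3 → M → ℝ}
    (hF : ∀ p, (c p : ℝ) = ∑ i, F i (latinLine i p)) :
    ∃ φ : M →+ UnitAddCircle, characterClass φ = Submodule.Quotient.mk c := by
  simp only [Fin.sum_univ_three, latinLine, Matrix.cons_val] at hF
  have h_circle (x y : M) : (F 0 x : UnitAddCircle) + F 1 y + F 2 (x + y) = 0 := by
    rw [← AddCircle.coe_add, ← AddCircle.coe_add, ← hF (x, y), coe_intCast_eq_zero]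
  obtain ⟨φ, hφ⟩ :=
    exists_addMonoidHom_of_add_eq_zero (F := fun i z ↦ (F i z : UnitAddCircle)) h_circle
  let G : Fin 3 → M → ℝ := ![fun z ↦ F 0 z - (φ z).out + F 1 0 + F 2 0,
    fun z ↦ F 1 z - (φ z).out - F 1 0, fun z ↦ F 2 z + (φ z).out - F 2 0]
  refine ⟨φ, (IncidenceQuotient.mk_eq_mk_of_coe_eq_zero G ?_ fun p ↦ ?_).symm⟩
  · intro i z
    have h_zero : (F 0 0 : UnitAddCircle) + F 1 0 + F 2 0 = 0 := by simpa using h_circle 0 0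
    fin_cases i <;> simp [G] <;> grind
  · simp only [hF, coe_characterCocycle, Fin.sum_univ_three, latinLine, Matrix.cons_val, G]
    ring

theorem exact_characterClass_toReal :
    Function.Exact (characterClass (M := M)) (IncidenceQuotient.toReal latinLine) := by
  intro q
  obtain ⟨c, rfl⟩ := Submodule.Quotient.mk_surjective _ q
  constructor
  · intro hc
    obtain ⟨F, hF⟩ := IncidenceQuotient.toReal_mk_eq_zero.mp hc
    exact exists_characterClass_eq_mk hF
  · rintro ⟨φ, hφ⟩
    rw [← hφ]
    refine IncidenceQuotient.toReal_mk_eq_zero.mpr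
      ⟨![fun z ↦ (φ z).out, fun z ↦ (φ z).out, fun z ↦ -(φ z).out], fun p ↦ ?_⟩
    simp only [coe_characterCocycle, latinLine, Fin.sum_univ_three, Matrix.cons_val,
      sub_eq_add_neg]

theorem nonempty_addMonoidHom_unitAddCircle_addEquiv (M : Type*) [AddCommGroup M] [Finite M] :
    Nonempty ((M →+ UnitAddCircle) ≃+ M) := by
  obtain ⟨duality⟩ :=
    CommGroup.monoidHom_mulEquiv_of_hasEnoughRootsOfUnity (Multiplicative M) Circle
  let circle : UnitAddCircle ≃+ Additive Circle :=
    { (AddCircle.homeomorphCircle (T := 1) one_ne_zero).toEquiv.trans Additive.ofMul with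
      map_add' := fun x y ↦ by
        simp [AddCircle.homeomorphCircle_apply, AddCircle.toCircle_add] }
  let characters : Multiplicative (M →+ UnitAddCircle) ≃* (Multiplicative M →* Circleˣ) :=
    circle.addMonoidHomCongrRight.toMultiplicative.trans
      (MonoidHom.toAdditiveRightMulEquiv.symm.trans toUnits.monoidHomCongrRight)
  exact ⟨AddEquiv.toMultiplicative.symm (characters.trans duality)⟩

theorem IncidenceQuotient.exists_addEquiv_prod_of_latinLine (M : Type*) [AddCommGroup M]
    [Finite M] :
    ∃ r : ℕ, Nonempty (IncidenceQuotient ℤ (latinLine (M := M)) ≃+ M × (Fin r → ℤ)) := by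
  have : IsAddTorsionFree (IncidenceQuotient ℝ (latinLine (M := M))) :=
    .of_isTorsionFree ℝ _
  have : AddGroup.FG (IncidenceQuotient ℤ (latinLine (M := M))) :=
    Module.Finite.iff_addGroup_fg.mp inferInstance
  obtain ⟨r, ⟨e⟩⟩ := exists_addEquiv_prod_of_exact characterClass_injective
    (exact_characterClass_toReal (M := M))
  obtain ⟨duality⟩ := nonempty_addMonoidHom_unitAddCircle_addEquiv M
  exact ⟨r, ⟨e.trans (duality.prodCongr (.refl _))⟩⟩

end Latin

/-! ### Kernels of cyclic characters -/

section CyclicKernel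

variable {G : Type*} [Group G]

theorem exists_mem_closure_conj_zpow_mul {S : Set G} {t : G}
    (hS : Subgroup.closure (insert t S) = ⊤) (x : G) :
    ∃ y ∈ Subgroup.closure {z | ∃ s ∈ S, ∃ k : ℤ, z = t ^ k * s * (t ^ k)⁻¹},
      ∃ k : ℤ, x = y * t ^ k := by
  have hx : x ∈ Subgroup.closure (insert t S) := hS ▸ Subgroup.mem_top x
  induction hx using Subgroup.closure_induction_right with
  | one => exact ⟨1, one_mem _, 0, by simp⟩
  | mul_right x _ s hs ih =>
    obtain ⟨y, hy, k, rfl⟩ := ih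
    obtain rfl | hs := hs
    · exact ⟨y, hy, k + 1, by rw [zpow_add_one, mul_assoc]⟩
    · exact ⟨_, mul_mem hy (Subgroup.subset_closure ⟨s, hs, k, rfl⟩), k, by group⟩
  | mul_inv_cancel x _ s hs ih =>
    obtain ⟨y, hy, k, rfl⟩ := ih
    obtain rfl | hs := hs
    · exact ⟨y, hy, k - 1, by rw [zpow_sub_one, mul_assoc]⟩
    · exact ⟨_, mul_mem hy (inv_mem (Subgroup.subset_closure ⟨s, hs, k, rfl⟩)), k, by group⟩

theorem closure_eq_ker_of_closure_insert_eq_top {S : Set G} {t : G} {n : ℕ}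
    (hS : Subgroup.closure (insert t S) = ⊤) {χ : G →* Multiplicative (ZMod n)}
    (ht : χ t = .ofAdd 1) (hχ : ∀ s ∈ S, χ s = 1) :
    Subgroup.closure (insert (t ^ n) {z | ∃ s ∈ S, ∃ k : ℤ, z = t ^ k * s * (t ^ k)⁻¹}) =
      χ.ker := by
  have h_conj : Subgroup.closure {z | ∃ s ∈ S, ∃ k : ℤ, z = t ^ k * s * (t ^ k)⁻¹} ≤ χ.ker := by
    rw [Subgroup.closure_le]
    rintro _ ⟨s, hs, k, rfl⟩
    simp [MonoidHom.mem_ker, hχ s hs]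
  have h_pow (k : ℤ) : χ (t ^ k) = .ofAdd (k : ZMod n) := by
    rw [map_zpow, ht, ← ofAdd_zsmul, zsmul_one]
  apply le_antisymm
  · refine (Subgroup.closure_le _).mpr (Set.insert_subset ?_ ((Subgroup.closure_le _).mp h_conj))
    rw [SetLike.mem_coe, MonoidHom.mem_ker, ← zpow_natCast, h_pow, Int.cast_natCast,
      ZMod.natCast_self, ofAdd_zero]
  · intro x hx
    obtain ⟨y, hy, k, rfl⟩ := exists_mem_closure_conj_zpow_mul hS x
    rw [MonoidHom.mem_ker, map_mul, h_conj hy, one_mul, h_pow, ofAdd_eq_one,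
      ZMod.intCast_zmod_eq_zero_iff_dvd] at hx
    obtain ⟨m, rfl⟩ := hx
    refine mul_mem (Subgroup.closure_mono (Set.subset_insert _ _) hy) ?_
    rw [zpow_mul, zpow_natCast]
    exact zpow_mem (Subgroup.subset_closure (Set.mem_insert _ _)) m

end CyclicKernel

section Wreath

variable {G D Q : Type*} [Group G] [Group Q]

/-- A homomorphism to a regular wreath product induces a homomorphism to the base group on the
subgroups acting trivially on the index set, by evaluation at the identity (Shapiro's lemma). -/
def wreathRestrict [Group D] (Φ : G →* D ≀ᵣ Q) (K : Subgroup G)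
    (hK : K ≤ (RegularWreathProduct.rightHom.comp Φ).ker) : K →* D where
  toFun x := (Φ x).left 1
  map_one' := by simp
  map_mul' x y := by
    have hx : (Φ x).right = 1 := hK x.2
    simp [hx]

variable [CommGroup D]

/-- The inclusion of the base group. -/
def wreathBase : (Q → D) →* D ≀ᵣ Q where
  toFun u := ⟨u, 1⟩
  map_one' := rfl
  map_mul' u v := by ext <;> simp

theorem wreath_conj (a : D ≀ᵣ Q) (u : Q → D) :
    a * wreathBase u * a⁻¹ = wreathBase fun q ↦ u (a.right⁻¹ * q) := by
  ext <;> simp [wreathBase]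

theorem wreath_pow_left (a : D ≀ᵣ Q) (n : ℕ) (q : Q) :
    (a ^ n).left q = ∏ i ∈ Finset.range n, a.left (a.right⁻¹ ^ i * q) := by
  induction n generalizing q with
  | zero => simp
  | succ n ih =>
    rw [pow_succ', RegularWreathProduct.mul_left, Pi.mul_apply, ih, Finset.prod_range_succ',
      mul_comm]
    simp [pow_succ, mul_assoc]

end Wreath

/-! ### Cyclic covers of surface groups -/

theorem map_eq_one_of_coe_mem_commutator {G B : Type*} [Group G] [CommGroup B] {K : Subgroup G}
    (φ : K →* B) {x : K} (hx : (x : G) ∈ ⁅K, K⁆) : φ x = 1 := by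
  rw [← Subgroup.map_subtype_commutator] at hx
  exact Abelianization.commutator_subset_ker φ
    ((Subgroup.mem_map_iff_mem K.subtype_injective).mp hx)

theorem prod_range_val_add_one {B : Type*} [CommGroup B] {n : ℕ} [NeZero n] {u : ZMod n → B}
    (hu : ∏ k, u k = 1) (k : ZMod n) :
    ∏ i ∈ Finset.range (k + 1).val, u i = (∏ i ∈ Finset.range k.val, u i) * u k := by
  have h_total : ∏ i ∈ Finset.range n, u i = 1 := by
    rw [← hu]
    refine Finset.prod_nbij' (fun i ↦ (i : ZMod n)) ZMod.val (by simp) (fun k _ ↦ ?_)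
      (fun i hi ↦ ?_) (by simp) (by simp)
    · exact Finset.mem_range.mpr k.val_lt
    · exact ZMod.val_cast_of_lt (Finset.mem_range.mp hi)
  have h_succ : (k.val + 1 : ℕ) = k + 1 := by simp
  conv_rhs => rw [← ZMod.natCast_zmod_val k, ZMod.val_natCast]
  rw [Nat.mod_eq_of_lt k.val_lt, ← Finset.prod_range_succ, ← h_succ]
  obtain h | h := (Nat.succ_le_of_lt k.val_lt).lt_or_eq
  · rw [ZMod.val_cast_of_lt h]
  · rw [← Nat.succ_eq_add_one, h, h_total, ZMod.natCast_self, ZMod.val_zero, Finset.prod_range_zero]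

theorem exists_add_one_mul_eq_of_prod_eq_one {B : Type*} [CommGroup B] {n : ℕ} [NeZero n] (c : B)
    {u : ZMod n → B} (hu : ∏ k, u k = 1) :
    ∃ h : ZMod n → B, h 0 = c ∧ ∀ k, h (k + 1) * u k = h k :=
  ⟨fun k ↦ c / ∏ i ∈ Finset.range k.val, u i, by simp, fun k ↦ by
    beta_reduce
    rw [prod_range_val_add_one hu, div_mul_eq_div_div, div_mul_cancel]⟩

namespace SurfaceGroup

open scoped commutatorElement

theorem prod_ofFn_eq_of_ne_zero {G : Type*} [Monoid G] {g : ℕ} [NeZero g] {f : Fin g → G}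
    (hf : ∀ i ≠ 0, f i = 1) : (List.ofFn f).prod = f 0 := by
  obtain ⟨g, rfl⟩ := Nat.exists_eq_succ_of_ne_zero (NeZero.ne g)
  rw [List.ofFn_succ, List.prod_cons, List.prod_eq_one (by simp [hf]), mul_one]

variable {g b : ℕ} [NeZero g]

theorem lift_surfaceRelator_of_commute {G : Type*} [Group G] (x : SurfaceGen g b → G)
    (hx : ∀ i ≠ 0, Commute (x (.a i)) (x (.b i))) :
    FreeGroup.lift x (surfaceRelator g b) =
      ⁅x (.a 0), x (.b 0)⁆ * (List.ofFn fun j ↦ x (.c j)).prod := by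
  have h_handles := prod_ofFn_eq_of_ne_zero (f := fun i ↦ ⁅x (.a i), x (.b i)⁆)
    fun i hi ↦ commutatorElement_eq_one_iff_commute.mpr (hx i hi)
  simpa [surfaceRelator, map_list_prod, List.map_ofFn, Function.comp_def,
    commutatorElement_def] using h_handles

variable (g b) in
/-- The generator `a₁`, a loop around the first handle. -/
def handle : SurfaceGroup g b := PresentedGroup.of (.a 0)

/-- The generators of a surface group other than `a₁`. -/
inductive PuncturedGen (g b : ℕ) [NeZero g]
  | a (i : {i : Fin g // i ≠ 0})
  | b (i : Fin g)
  | c (j : Fin b)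

namespace PuncturedGen

/-- The generator as a generator of the surface group. -/
def toSurfaceGen : PuncturedGen g b → SurfaceGen g b
  | .a i => .a i
  | .b i => .b i
  | .c j => .c j

/-- The element of the surface group represented by the generator. -/
def elt (s : PuncturedGen g b) : SurfaceGroup g b := PresentedGroup.of s.toSurfaceGen

end PuncturedGen

theorem closure_insert_handle_eq_top :
    Subgroup.closure (insert (handle g b) (Set.range PuncturedGen.elt)) =
      (⊤ : Subgroup (SurfaceGroup g b)) := by
  rw [eq_top_iff, ← PresentedGroup.closure_range_of]
  refine Subgroup.closure_mono ?_
  rintro _ ⟨s, rfl⟩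
  match s with
  | .a i =>
    by_cases hi : i = 0
    · exact hi ▸ Set.mem_insert _ _
    · exact Set.mem_insert_of_mem _ ⟨.a ⟨i, hi⟩, rfl⟩
  | .b i => exact Set.mem_insert_of_mem _ ⟨.b i, rfl⟩
  | .c j => exact Set.mem_insert_of_mem _ ⟨.c j, rfl⟩

/-- The homomorphism to a group `G` given by an image `t` of `a₁` and images of the remaining
generators, which have to commute within each of the other handles. -/
def liftOfCommute {G : Type*} [Group G] (t : G) (x : PuncturedGen g b → G)
    (hx : ∀ i, Commute (x (.a i)) (x (.b i)))
    (h : ⁅t, x (.b 0)⁆ * (List.ofFn fun j ↦ x (.c j)).prod = 1) : SurfaceGroup g b →* G :=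
  let y : SurfaceGen g b → G
    | .a i => if hi : i = 0 then t else x (.a ⟨i, hi⟩)
    | .b i => x (.b i)
    | .c j => x (.c j)
  PresentedGroup.toGroup (f := y) <| by
    rintro _ rfl
    rw [lift_surfaceRelator_of_commute y fun i hi ↦ ?_]
    · simpa [y] using h
    · simpa [y, hi] using hx ⟨i, hi⟩

section liftOfCommute

variable {G : Type*} [Group G] {t : G} {x : PuncturedGen g b → G}
  {hx : ∀ i, Commute (x (.a i)) (x (.b i))}
  {h : ⁅t, x (.b 0)⁆ * (List.ofFn fun j ↦ x (.c j)).prod = 1}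

@[simp]
theorem liftOfCommute_handle : liftOfCommute t x hx h (handle g b) = t := by
  simp [liftOfCommute, handle]

@[simp]
theorem liftOfCommute_elt (s : PuncturedGen g b) : liftOfCommute t x hx h s.elt = x s := by
  rcases s with ⟨i, hi⟩ | _ | _ <;>
    simp [liftOfCommute, PuncturedGen.elt, PuncturedGen.toSurfaceGen, *]

end liftOfCommute

theorem commutator_handle_mul_prod_eq_one {G : Type*} [Group G] (φ : SurfaceGroup g b →* G)
    (hφ : ∀ i : {i : Fin g // i ≠ 0},
      Commute (φ (PuncturedGen.a i).elt) (φ (PuncturedGen.b i).elt)) :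
    ⁅φ (handle g b), φ (PuncturedGen.b 0).elt⁆ *
      (List.ofFn fun j ↦ φ (PuncturedGen.c j).elt).prod = 1 := by
  have h_lift : FreeGroup.lift (φ ∘ PresentedGroup.of) = φ.comp (PresentedGroup.mk _) :=
    FreeGroup.ext_hom _ _ fun _ ↦ FreeGroup.lift_apply_of
  have h_rel := lift_surfaceRelator_of_commute (φ ∘ PresentedGroup.of) fun i hi ↦ hφ ⟨i, hi⟩
  rw [h_lift, MonoidHom.comp_apply, PresentedGroup.one_of_mem (Set.mem_singleton _),
    map_one] at h_rel
  exact h_rel.symm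

theorem commutator_handle_mul_prod_mem_commutator (K : Subgroup (SurfaceGroup g b)) [K.Normal]
    (hK : ∀ s : PuncturedGen g b, s.elt ∈ K) :
    ⁅handle g b, (PuncturedGen.b 0).elt⁆ * (List.ofFn fun j ↦ (PuncturedGen.c j).elt).prod ∈
      ⁅K, K⁆ := by
  have h_comm (s t : PuncturedGen g b) :
      Commute (QuotientGroup.mk' ⁅K, K⁆ s.elt) (QuotientGroup.mk' ⁅K, K⁆ t.elt) := by
    rw [← commutatorElement_eq_one_iff_commute, ← map_commutatorElement]
    exact (QuotientGroup.eq_one_iff _).mpr (Subgroup.commutator_mem_commutator (hK s) (hK t))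
  rw [← QuotientGroup.eq_one_iff, ← QuotientGroup.mk'_apply,
    ← commutator_handle_mul_prod_eq_one (QuotientGroup.mk' ⁅K, K⁆) fun i ↦ h_comm (.a i) _]
  simp only [map_mul, map_commutatorElement, map_list_prod, List.map_ofFn, Function.comp_def]

/-- The character modulo `n` which is `1` on `a₁` and vanishes on the remaining generators; its
kernel is the fundamental group of an `n`-sheeted cyclic cover to which all the boundary loops
lift as loops. -/
def handleChar (g b n : ℕ) [NeZero g] : SurfaceGroup g b →* Multiplicative (ZMod n) :=
  liftOfCommute (.ofAdd 1) 1 (fun _ ↦ .all _ _) <| by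
    simp

@[simp]
theorem handleChar_handle (n : ℕ) : handleChar g b n (handle g b) = .ofAdd 1 :=
  liftOfCommute_handle

@[simp]
theorem handleChar_elt (n : ℕ) (s : PuncturedGen g b) : handleChar g b n s.elt = 1 :=
  liftOfCommute_elt s

/-- The fundamental group of the `n`-sheeted cyclic cover. -/
abbrev CyclicCover (g b n : ℕ) [NeZero g] : Subgroup (SurfaceGroup g b) := (handleChar g b n).ker

namespace CyclicCover

variable {n : ℕ}

/-- The loop which maps to the `n`-th power of `a₁`. -/
def root (g b n : ℕ) [NeZero g] : CyclicCover g b n :=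
  ⟨handle g b ^ n, by simp [MonoidHom.mem_ker, ← ofAdd_nsmul]⟩

/-- The lift of a generator to the sheet `k`. -/
def lift (s : PuncturedGen g b) (k : ZMod n) : CyclicCover g b n :=
  ⟨handle g b ^ (k.cast : ℤ) * s.elt * (handle g b ^ (k.cast : ℤ))⁻¹, by
    simp [MonoidHom.mem_ker]⟩

variable {B : Type*} [CommGroup B]

theorem map_conjNormal_elt (φ : CyclicCover g b n →* B) (s : PuncturedGen g b) (k : ℤ) :
    φ (MulAut.conjNormal (handle g b ^ k) ⟨s.elt, handleChar_elt n s⟩) = φ (lift s k) := by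
  obtain ⟨m, hm⟩ : (n : ℤ) ∣ k - ((k : ZMod n).cast : ℤ) := by
    rw [← ZMod.intCast_zmod_eq_zero_iff_dvd]
    simp
  have h_pow : handle g b ^ k = (handle g b ^ n) ^ m * handle g b ^ ((k : ZMod n).cast : ℤ) := by
    rw [← zpow_natCast, ← zpow_mul, ← hm, ← zpow_add, sub_add_cancel]
  have h : MulAut.conjNormal (handle g b ^ k) ⟨s.elt, handleChar_elt n s⟩ =
      root g b n ^ m * lift s k * (root g b n ^ m)⁻¹ := by
    ext1
    simp only [MulAut.conjNormal_apply, lift, root, Subgroup.coe_mul, Subgroup.coe_inv,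
      Subgroup.coe_zpow, h_pow]
    group
  rw [h, map_mul, map_mul, map_inv, mul_inv_cancel_comm]

theorem hom_ext {φ ψ : CyclicCover g b n →* B} (h_root : φ (root g b n) = ψ (root g b n))
    (h_lift : ∀ s k, φ (lift s k) = ψ (lift s k)) : φ = ψ := by
  have h_closure := closure_eq_ker_of_closure_insert_eq_top closure_insert_handle_eq_top
    (handleChar_handle (g := g) (b := b) n) (by rintro _ ⟨s, rfl⟩; exact handleChar_elt n s)
  suffices h : (handleChar g b n).ker ≤ (φ.eqLocus ψ).map (CyclicCover g b n).subtype by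
    ext x
    obtain ⟨y, hy, hyx⟩ := h x.2
    exact Subtype.ext (a1 := y) hyx ▸ hy
  rw [← h_closure, Subgroup.closure_le]
  rintro _ (rfl | ⟨_, ⟨s, rfl⟩, k, rfl⟩)
  · exact ⟨_, h_root, rfl⟩
  · refine ⟨MulAut.conjNormal (handle g b ^ k) ⟨s.elt, handleChar_elt n s⟩, ?_, rfl⟩
    exact (map_conjNormal_elt φ s k).trans ((h_lift s k).trans (map_conjNormal_elt ψ s k).symm)

theorem map_lift_add_one_mul_prod (φ : CyclicCover g b n →* B) (k : ZMod n) :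
    φ (lift (.b 0) (k + 1)) * ∏ j, φ (lift (.c j) k) = φ (lift (.b 0) k) := by
  let x (s : PuncturedGen g b) : CyclicCover g b n := ⟨s.elt, handleChar_elt n s⟩
  let conj (l : ℤ) : MulAut (CyclicCover g b n) := MulAut.conjNormal (handle g b ^ l)
  let z := conj 1 (x (.b 0)) * (x (.b 0))⁻¹ * (List.ofFn fun j ↦ x (.c j)).prod
  have hz : (φ.comp (conj k.cast).toMonoidHom) z = 1 := by
    refine map_eq_one_of_coe_mem_commutator _ ?_
    convert commutator_handle_mul_prod_mem_commutator (CyclicCover g b n) (handleChar_elt n)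
    simp [z, conj, x, commutatorElement_def, List.map_ofFn, Function.comp_def]
  have h_conj (l : ℤ) (s) : φ (conj l (x s)) = φ (lift s l) := map_conjNormal_elt φ s l
  have h_add : conj k.cast (conj 1 (x (.b 0))) = conj (k.cast + 1) (x (.b 0)) := by
    simp only [conj, zpow_add, map_mul, MulAut.mul_apply]
  simp only [z, map_mul, map_inv, MonoidHom.comp_apply, MulEquiv.coe_toMonoidHom, h_add,
    map_list_prod, List.map_ofFn, Function.comp_def, List.prod_ofFn, h_conj, Int.cast_add,
    ZMod.intCast_zmod_cast, Int.cast_one] at hz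
  rwa [mul_right_comm, mul_inv_eq_one] at hz

/-- The images of the generators other than `a₁` under the homomorphism to a wreath product which
corresponds to a homomorphism with the values `f` at the lifts of the generators. -/
def wreathGen (f : PuncturedGen g b → ZMod n → B) (s : PuncturedGen g b) :
    B ≀ᵣ Multiplicative (ZMod n) :=
  wreathBase fun q ↦ f s (-q.toAdd)

theorem wreathGen_relation (a : B ≀ᵣ Multiplicative (ZMod n)) (ha : a.right = .ofAdd 1)
    {f : PuncturedGen g b → ZMod n → B}
    (hf : ∀ k, f (.b 0) (k + 1) * ∏ j, f (.c j) k = f (.b 0) k) :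
    ⁅a, wreathGen f (.b 0)⁆ * (List.ofFn fun j ↦ wreathGen f (.c j)).prod = 1 := by
  have h_prod : (List.ofFn fun j ↦ wreathGen f (.c j)).prod =
      wreathBase fun q ↦ ∏ j, f (.c j) (-q.toAdd) := by
    have : (fun j ↦ wreathGen f (.c j)) = wreathBase ∘ fun j q ↦ f (.c j) (-q.toAdd) := rfl
    rw [this, ← List.map_ofFn, ← map_list_prod, List.prod_ofFn]
    exact congrArg wreathBase (funext fun q ↦ Finset.prod_apply ..)
  rw [commutatorElement_def, h_prod, wreathGen, wreath_conj, ← map_inv, ← map_mul, ← map_mul,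
    ← map_one wreathBase]
  refine congrArg wreathBase (funext fun q ↦ ?_)
  rw [Pi.mul_apply, Pi.mul_apply, mul_right_comm, Pi.inv_apply, Pi.one_apply, mul_inv_eq_one, ha,
    ← hf (-q.toAdd), toAdd_mul, toAdd_inv, toAdd_ofAdd, neg_add, neg_neg, add_comm]

theorem exists_hom [NeZero n] (α : B) (f : PuncturedGen g b → ZMod n → B)
    (hf : ∀ k, f (.b 0) (k + 1) * ∏ j, f (.c j) k = f (.b 0) k) :
    ∃ φ : CyclicCover g b n →* B, φ (root g b n) = α ∧ ∀ s k, φ (lift s k) = f s k := by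
  let a : B ≀ᵣ Multiplicative (ZMod n) := ⟨Pi.mulSingle 1 α, .ofAdd 1⟩
  let Φ : SurfaceGroup g b →* B ≀ᵣ Multiplicative (ZMod n) :=
    liftOfCommute a (wreathGen f) (fun i ↦ (Commute.all _ _).map wreathBase)
      (wreathGen_relation a rfl hf)
  have h_handle : Φ (handle g b) = a := liftOfCommute_handle
  have h_elt (s) : Φ (PuncturedGen.elt s) = wreathGen f s := liftOfCommute_elt s
  have h_right : RegularWreathProduct.rightHom.comp Φ = handleChar g b n := by
    refine MonoidHom.eq_of_eqOn_dense closure_insert_handle_eq_top ?_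
    rintro _ (rfl | ⟨s, rfl⟩)
    · simp [h_handle, a]
    · simp [h_elt, wreathGen, wreathBase]
  refine ⟨wreathRestrict Φ _ (congrArg MonoidHom.ker h_right).ge, ?_, fun s k ↦ ?_⟩
  · change (Φ (handle g b ^ n)).left 1 = α
    rw [map_pow, h_handle, wreath_pow_left, Finset.prod_eq_single_of_mem 0 (by simp [NeZero.pos])]
    · simp [a]
    · intro i hi hi'
      have h_ne : (i : ZMod n) ≠ 0 := fun h ↦ Nat.not_dvd_of_pos_of_lt (Nat.pos_of_ne_zero hi')
        (Finset.mem_range.mp hi) ((ZMod.natCast_eq_zero_iff i n).mp h)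
      exact Pi.mulSingle_eq_of_ne (by simpa [a, ← ofAdd_nsmul] using h_ne) _
  · have h_pow : (a ^ (k.cast : ℤ)).right = .ofAdd k := by
      rw [← RegularWreathProduct.rightHom_eq_right, map_zpow]
      simp [a, ← ofAdd_zsmul]
    change (Φ (handle g b ^ (k.cast : ℤ) * s.elt * (handle g b ^ (k.cast : ℤ))⁻¹)).left 1 = f s k
    rw [map_mul, map_mul, map_inv, map_zpow, h_handle, h_elt, wreathGen, wreath_conj, h_pow]
    simp [wreathBase]

/-- A basis of the first homology of the cyclic cover modulo the boundary: all the generators given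
by `root` and `lift` except those on the boundary and those of the form `lift (.b 0) k` with
`k ≠ 0`. -/
inductive FreeGen (g n : ℕ) [NeZero g]
  | root
  | base
  | a (i : {i : Fin g // i ≠ 0}) (k : ZMod n)
  | b (i : {i : Fin g // i ≠ 0}) (k : ZMod n)

instance [NeZero n] : Finite (FreeGen g n) := by
  let f : Option (Option ({i : Fin g // i ≠ 0} × ZMod n ⊕ {i : Fin g // i ≠ 0} × ZMod n)) →
      FreeGen g n
    | none => .root
    | some none => .base
    | some (some (.inl x)) => .a x.1 x.2
    | some (some (.inr x)) => .b x.1 x.2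
  refine Finite.of_surjective f ?_
  rintro (_ | _ | ⟨i, k⟩ | ⟨i, k⟩)
  exacts [⟨none, rfl⟩, ⟨some none, rfl⟩, ⟨some (some (.inl (i, k))), rfl⟩,
    ⟨some (some (.inr (i, k))), rfl⟩]

/-- The element of the cover represented by a generator. -/
def FreeGen.elt : FreeGen g n → CyclicCover g b n
  | .root => CyclicCover.root g b n
  | .base => lift (.b 0) 0
  | .a i k => lift (.a i) k
  | .b i k => lift (.b i) k

variable (g) in
/-- The lift of a boundary loop to the sheet `k`. -/
def boundaryLift (j : Fin b) (k : ZMod n) : CyclicCover g b n := lift (.c j) k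

theorem hom_ext_of_boundary {φ ψ : CyclicCover g b n →* B}
    (h_free : ∀ x : FreeGen g n, φ x.elt = ψ x.elt)
    (h_boundary : ∀ j k, φ (boundaryLift g j k) = ψ (boundaryLift g j k)) : φ = ψ := by
  have h_step (k : ZMod n) : φ (lift (.b 0) (k + 1)) = ψ (lift (.b 0) (k + 1)) ↔
      φ (lift (.b 0) k) = ψ (lift (.b 0) k) := by
    have h_prod : ∏ j, φ (lift (.c j) k) = ∏ j, ψ (lift (.c j) k) :=
      Finset.prod_congr rfl fun j _ ↦ h_boundary j k
    rw [← map_lift_add_one_mul_prod φ k, ← map_lift_add_one_mul_prod ψ k, h_prod, mul_left_inj]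
  have h_base (k : ZMod n) : φ (lift (.b 0) k) = ψ (lift (.b 0) k) := by
    obtain ⟨m, rfl⟩ := ZMod.intCast_surjective k
    induction m with
    | zero => exact Int.cast_zero (R := ZMod n) ▸ h_free .base
    | succ m ih => exact_mod_cast (h_step _).mpr ih
    | pred m ih => exact (h_step _).mp (by simpa using ih)
  refine hom_ext (h_free .root) fun s k ↦ ?_
  match s with
  | .a i => exact h_free (.a i k)
  | .b i =>
    by_cases hi : i = 0
    · exact hi ▸ h_base k
    · exact h_free (.b ⟨i, hi⟩ k)
  | .c j => exact h_boundary j k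

variable [NeZero n]

theorem prod_map_boundaryLift (φ : CyclicCover g b n →* B) :
    ∏ k, ∏ j, φ (boundaryLift g j k) = 1 := by
  have h (k : ZMod n) : ∏ j, φ (boundaryLift g j k) =
      φ (lift (.b 0) k) / φ (lift (.b 0) (k + 1)) :=
    eq_div_of_mul_eq'' (map_lift_add_one_mul_prod φ k)
  simp only [h, Finset.prod_div_distrib, div_eq_one]
  exact (Equiv.prod_comp (Equiv.addRight 1) fun k ↦ φ (lift (.b 0) k)).symm

theorem exists_hom_of_prod_eq_one (f : FreeGen g n → B) (β : Fin b → ZMod n → B)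
    (hβ : ∏ k, ∏ j, β j k = 1) :
    ∃ φ : CyclicCover g b n →* B,
      (∀ x, φ (FreeGen.elt x) = f x) ∧ ∀ j k, φ (boundaryLift g j k) = β j k := by
  obtain ⟨h, h_zero, h_add_one⟩ := exists_add_one_mul_eq_of_prod_eq_one (f .base) hβ
  let f' : PuncturedGen g b → ZMod n → B
    | .a i, k => f (.a i k)
    | .b i, k => if hi : i = 0 then h k else f (.b ⟨i, hi⟩ k)
    | .c j, k => β j k
  obtain ⟨φ, h_root, h_lift⟩ := exists_hom (f .root) f' (by simpa [f'] using h_add_one)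
  refine ⟨φ, fun x ↦ ?_, fun j k ↦ h_lift _ _⟩
  match x with
  | .root => exact h_root
  | .base => exact (h_lift _ _).trans h_zero
  | .a i k => exact h_lift _ _
  | .b i k => exact (h_lift _ _).trans (dif_neg i.2)

end CyclicCover

end SurfaceGroup

/-! ### The first homology of a graph of groups -/

namespace GraphOfGroups

variable {𝒢 : GraphOfGroups.{u}}

theorem letter_mul_elt {v w : 𝒢.V} (e : 𝒢.E v w) (x : 𝒢.EG e) :
    𝒢.letter e * 𝒢.elt w (𝒢.φτ e x) = 𝒢.elt v (𝒢.φι e x) * 𝒢.letter e := by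
  have := PresentedGroup.one_of_mem (rels := {r : FreeGroup 𝒢.Gen | 𝒢.Rel r}) (Rel.conj e x)
  rw [map_mul, map_mul, map_mul, map_inv, map_inv, mul_inv_eq_one, mul_inv_eq_iff_eq_mul] at this
  exact this

namespace PathGroup

/-- The homomorphism from a vertex group to the path group. -/
def eltHom (v : 𝒢.V) : 𝒢.VG v →* 𝒢.PathGroup where
  toFun := 𝒢.elt v
  map_one' := elt_one v
  map_mul' := elt_mul v

section Lift

variable {B : Type*} [Group B]

/-- The homomorphism out of the path group with prescribed values on the vertex groups and on the
stable letters. -/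
def lift (ψ : ∀ v, 𝒢.VG v →* B) (t : ∀ {v w : 𝒢.V}, 𝒢.E v w → B)
    (h : ∀ (v w : 𝒢.V) (e : 𝒢.E v w) (x : 𝒢.EG e), t e * ψ w (𝒢.φτ e x) = ψ v (𝒢.φι e x) * t e) :
    𝒢.PathGroup →* B :=
  PresentedGroup.toGroup (f := fun | .elt v g => ψ v g | .edge e => t e) (by
    rintro r (⟨v, a, b⟩ | ⟨e, x⟩)
    · simp
    · simp [h])

variable {ψ : ∀ v, 𝒢.VG v →* B} {t : ∀ {v w : 𝒢.V}, 𝒢.E v w → B}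
  (h : ∀ (v w : 𝒢.V) (e : 𝒢.E v w) (x : 𝒢.EG e), t e * ψ w (𝒢.φτ e x) = ψ v (𝒢.φι e x) * t e)

@[simp]
theorem lift_elt (v : 𝒢.V) (g : 𝒢.VG v) : lift ψ t h (𝒢.elt v g) = ψ v g :=
  PresentedGroup.toGroup.of _

@[simp]
theorem lift_letter {v w : 𝒢.V} (e : 𝒢.E v w) : lift ψ t h (𝒢.letter e) = t e :=
  PresentedGroup.toGroup.of _

theorem hom_ext {φ ψ : 𝒢.PathGroup →* B} (h_elt : ∀ v g, φ (𝒢.elt v g) = ψ (𝒢.elt v g))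
    (h_letter : ∀ {v w : 𝒢.V} (e : 𝒢.E v w), φ (𝒢.letter e) = ψ (𝒢.letter e)) : φ = ψ := by
  apply PresentedGroup.ext
  rintro (⟨v, g⟩ | e)
  · exact h_elt v g
  · exact h_letter e

end Lift

end PathGroup

theorem exists_isPath (v w : 𝒢.V) : ∃ x, 𝒢.IsPath v w x := by
  induction 𝒢.connected v w with
  | rel a b h => exact ⟨_, .letter h.some⟩
  | refl a => exact ⟨_, .elt a 1⟩
  | symm a b _ ih => obtain ⟨x, hx⟩ := ih; exact ⟨_, hx.inv⟩
  | trans a b c _ _ ih ih' =>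
    obtain ⟨x, hx⟩ := ih
    obtain ⟨y, hy⟩ := ih'
    exact ⟨_, hx.mul hy⟩

/-- A chosen path between two vertices. -/
noncomputable def chosenPath (v w : 𝒢.V) : 𝒢.PathGroup := (exists_isPath v w).choose

theorem isPath_chosenPath (v w : 𝒢.V) : 𝒢.IsPath v w (chosenPath v w) :=
  (exists_isPath v w).choose_spec

/-- The homomorphism from the path group to the fundamental group that closes up a path from `v`
to `w` by the chosen paths from the base point to `v` and to `w`. -/
noncomputable def retraction (v₀ : 𝒢.V) : 𝒢.PathGroup →* 𝒢.π₁ v₀ :=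
  PathGroup.lift
    (fun v ↦
      { toFun := fun g ↦ ⟨chosenPath v₀ v * 𝒢.elt v g * (chosenPath v₀ v)⁻¹,
          ((isPath_chosenPath v₀ v).mul (.elt v g)).mul (isPath_chosenPath v₀ v).inv⟩
        map_one' := by ext; simp [elt_one]
        map_mul' := fun g h ↦ by ext; simp [elt_mul] })
    (fun {v w} e ↦ ⟨chosenPath v₀ v * 𝒢.letter e * (chosenPath v₀ w)⁻¹,
      ((isPath_chosenPath v₀ v).mul (.letter e)).mul (isPath_chosenPath v₀ w).inv⟩)
    (fun _ _ e x ↦ by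
      ext
      have := letter_mul_elt e x
      simp only [MonoidHom.coe_mk, OneHom.coe_mk, Subgroup.coe_mul, mul_assoc,
        inv_mul_cancel_left]
      rw [← mul_assoc (𝒢.letter e), this, mul_assoc])

theorem coe_retraction_of_isPath (v₀ : 𝒢.V) {v w : 𝒢.V} {x : 𝒢.PathGroup}
    (hx : 𝒢.IsPath v w x) :
    (retraction v₀ x : 𝒢.PathGroup) = chosenPath v₀ v * x * (chosenPath v₀ w)⁻¹ := by
  induction hx with
  | elt v g => exact congrArg Subtype.val (PathGroup.lift_elt _ v g)
  | letter e => exact congrArg Subtype.val (PathGroup.lift_letter _ e)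
  | letter_inv e =>
    rw [map_inv, retraction, PathGroup.lift_letter, Subgroup.coe_inv]
    group
  | mul _ _ hx hy =>
    rw [map_mul, Subgroup.coe_mul, hx, hy]
    group

section CommGroup

variable {B : Type*} [CommGroup B]

theorem map_retraction_coe {v₀ : 𝒢.V} (φ : 𝒢.π₁ v₀ →* B) (x : 𝒢.π₁ v₀) :
    φ (retraction v₀ (x : 𝒢.PathGroup)) = φ x := by
  let p : 𝒢.π₁ v₀ := ⟨chosenPath v₀ v₀, isPath_chosenPath v₀ v₀⟩
  have : retraction v₀ (x : 𝒢.PathGroup) = p * x * p⁻¹ :=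
    Subtype.ext (coe_retraction_of_isPath v₀ x.2)
  rw [this, map_mul, map_mul, map_inv, mul_inv_cancel_comm]

theorem map_coe_retraction_elt (φ : 𝒢.PathGroup →* B) (v₀ v : 𝒢.V) (g : 𝒢.VG v) :
    φ (retraction v₀ (𝒢.elt v g) : 𝒢.PathGroup) = φ (𝒢.elt v g) := by
  rw [coe_retraction_of_isPath v₀ (.elt v g), map_mul, map_mul, map_inv, mul_inv_cancel_comm]

end CommGroup

theorem nonempty_H₁_addEquiv (v w : 𝒢.V) : Nonempty (𝒢.H₁ v ≃+ 𝒢.H₁ w) := by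
  have hp := isPath_chosenPath v w
  let conj : 𝒢.π₁ v ≃* 𝒢.π₁ w :=
    { toFun := fun x ↦ ⟨(chosenPath v w)⁻¹ * x * chosenPath v w, (hp.inv.mul x.2).mul hp⟩
      invFun := fun x ↦ ⟨chosenPath v w * x * (chosenPath v w)⁻¹, (hp.mul x.2).mul hp.inv⟩
      left_inv := fun x ↦ by ext; simp [mul_assoc]
      right_inv := fun x ↦ by ext; simp [mul_assoc]
      map_mul' := fun x y ↦ by ext; simp [mul_assoc] }
  exact ⟨conj.abelianizationCongr.toAdditive⟩

variable (𝒢) in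
/-- The cokernel of `⨁ₑ H₁(G_e) → ⨁ᵥ H₁(G_v)`, that is, the largest abelian quotient of the free
product of the vertex groups in which both edge maps of every edge agree. It is encoded as the
quotient of the abelianized path group by the stable letters. -/
abbrev VertexHomology : Type u :=
  Additive (Abelianization 𝒢.PathGroup) ⧸
    AddSubgroup.closure {a | ∃ (v w : 𝒢.V) (e : 𝒢.E v w), a = .ofMul (.of (𝒢.letter e))}

namespace VertexHomology

/-- The projection of the path group, which is trivial on the stable letters. -/
def proj : 𝒢.PathGroup →* Multiplicative 𝒢.VertexHomology :=
  (AddMonoidHom.toMultiplicativeRight (QuotientAddGroup.mk' _)).comp Abelianization.of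

theorem proj_letter {v w : 𝒢.V} (e : 𝒢.E v w) : proj (𝒢.letter e) = 1 :=
  (QuotientAddGroup.eq_zero_iff _).mpr (AddSubgroup.subset_closure ⟨v, w, e, rfl⟩)

/-- The class of an element of a vertex group in `VertexHomology`. -/
def vertexClass (v : 𝒢.V) : 𝒢.VG v →* Multiplicative 𝒢.VertexHomology :=
  proj.comp (PathGroup.eltHom v)

theorem vertexClass_φι {v w : 𝒢.V} (e : 𝒢.E v w) (x : 𝒢.EG e) :
    vertexClass v (𝒢.φι e x) = vertexClass w (𝒢.φτ e x) := by
  have := congrArg proj (letter_mul_elt e x)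
  rwa [map_mul, map_mul, proj_letter, one_mul, mul_one, eq_comm] at this

variable {B : Type*} [AddCommGroup B]

/-- The homomorphism with prescribed restrictions to the vertex groups. -/
def lift (ψ : ∀ v, 𝒢.VG v →* Multiplicative B)
    (h : ∀ (v w : 𝒢.V) (e : 𝒢.E v w) (x : 𝒢.EG e), ψ v (𝒢.φι e x) = ψ w (𝒢.φτ e x)) :
    𝒢.VertexHomology →+ B :=
  QuotientAddGroup.lift _
    (MonoidHom.toAdditiveLeft (Abelianization.lift (PathGroup.lift ψ (fun _ ↦ 1) fun v w e x ↦ by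
      rw [one_mul, mul_one, h])))
    ((AddSubgroup.closure_le _).mpr <| by
      rintro _ ⟨v, w, e, rfl⟩
      simp)

@[simp]
theorem lift_vertexClass {ψ : ∀ v, 𝒢.VG v →* Multiplicative B}
    (h : ∀ (v w : 𝒢.V) (e : 𝒢.E v w) (x : 𝒢.EG e), ψ v (𝒢.φι e x) = ψ w (𝒢.φτ e x))
    (v : 𝒢.V) (x : 𝒢.VG v) : lift ψ h (vertexClass v x).toAdd = (ψ v x).toAdd :=
  congrArg Multiplicative.toAdd
    (PathGroup.lift_elt (fun v w e x ↦ by rw [one_mul, mul_one, h]) v x)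

theorem hom_ext {φ ψ : 𝒢.VertexHomology →+ B}
    (h : ∀ v x, φ (vertexClass v x).toAdd = ψ (vertexClass v x).toAdd) : φ = ψ := by
  ext (⟨v, x⟩ | e)
  · exact h v x
  · have : ((proj (𝒢.letter e)).toAdd : 𝒢.VertexHomology) = 0 := proj_letter e
    exact (congrArg φ this).trans ((map_zero φ).trans ((congrArg ψ this).trans (map_zero ψ)).symm)

/-- The homomorphism to the first homology induced by joining the vertices to the base point. -/
noncomputable def toH₁ (v₀ : 𝒢.V) : 𝒢.VertexHomology →+ 𝒢.H₁ v₀ :=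
  lift (fun v ↦ (Abelianization.of.comp (retraction v₀)).comp (PathGroup.eltHom v))
    fun v w e x ↦ by
      have := congrArg (Abelianization.of.comp (retraction v₀)) (letter_mul_elt e x)
      rw [map_mul, map_mul, mul_comm] at this
      exact (mul_right_cancel this).symm

theorem toH₁_vertexClass (v₀ v : 𝒢.V) (x : 𝒢.VG v) :
    toH₁ v₀ (vertexClass v x).toAdd = .ofMul (.of (retraction v₀ (𝒢.elt v x))) :=
  lift_vertexClass _ v x

theorem toH₁_injective (v₀ : 𝒢.V) : Function.Injective (toH₁ v₀) := by
  let fromH₁ : 𝒢.H₁ v₀ →+ 𝒢.VertexHomology :=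
    MonoidHom.toAdditiveLeft (Abelianization.lift (proj.comp (𝒢.π₁ v₀).subtype))
  have : fromH₁.comp (toH₁ v₀) = .id _ := hom_ext fun v x ↦ by
    rw [AddMonoidHom.comp_apply, toH₁_vertexClass]
    exact congrArg Multiplicative.toAdd (map_coe_retraction_elt proj v₀ v x)
  exact Function.LeftInverse.injective (DFunLike.congr_fun this)

end VertexHomology

variable (𝒢) in
/-- The signed numbers of traversals of the edges by an element of the path group. -/
noncomputable def edgeCount : 𝒢.PathGroup →* Multiplicative ((Σ v w, 𝒢.E v w) →₀ ℤ) :=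
  PathGroup.lift (fun _ ↦ 1) (fun {v w} e ↦ .ofAdd (.single ⟨v, w, e⟩ 1)) fun _ _ _ _ ↦ by
    simp

/-- The map from `H₁` to the `1`-chains of the underlying graph. -/
noncomputable def H₁.edgeCount (v₀ : 𝒢.V) : 𝒢.H₁ v₀ →+ ((Σ v w, 𝒢.E v w) →₀ ℤ) :=
  MonoidHom.toAdditiveLeft (Abelianization.lift (𝒢.edgeCount.comp (𝒢.π₁ v₀).subtype))

open VertexHomology in
theorem exact_toH₁_edgeCount (v₀ : 𝒢.V) : Function.Exact (toH₁ v₀) (H₁.edgeCount v₀) := by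
  let fromEdges : ((Σ v w, 𝒢.E v w) →₀ ℤ) →+ 𝒢.H₁ v₀ :=
    Finsupp.liftAddHom fun e ↦ zmultiplesHom _ (.ofMul (.of (retraction v₀ (𝒢.letter e.2.2))))
  have decomposition : Abelianization.of.comp (retraction v₀) =
      (AddMonoidHom.toMultiplicativeLeft (toH₁ v₀)).comp proj *
        (AddMonoidHom.toMultiplicativeLeft fromEdges).comp 𝒢.edgeCount :=
    PathGroup.hom_ext
      (fun v x ↦ by
        have : 𝒢.edgeCount (𝒢.elt v x) = 1 := PathGroup.lift_elt _ v x
        rw [MonoidHom.mul_apply, MonoidHom.comp_apply _ 𝒢.edgeCount, this, map_one, mul_one]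
        exact (toH₁_vertexClass v₀ v x).symm)
      fun {v w} e ↦ by
        have : 𝒢.edgeCount (𝒢.letter e) = .ofAdd (.single ⟨v, w, e⟩ 1) :=
          PathGroup.lift_letter _ e
        rw [MonoidHom.mul_apply, MonoidHom.comp_apply _ proj, proj_letter, map_one, one_mul,
          MonoidHom.comp_apply _ 𝒢.edgeCount, this]
        simp [fromEdges]
  have h_comp : (H₁.edgeCount v₀).comp (toH₁ v₀) = 0 := hom_ext fun v x ↦ by
    rw [AddMonoidHom.comp_apply, toH₁_vertexClass]
    exact (map_coe_retraction_elt 𝒢.edgeCount v₀ v x).trans (PathGroup.lift_elt _ v x)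
  intro a
  refine ⟨fun ha ↦ ?_, ?_⟩
  · obtain ⟨x, rfl⟩ : ∃ x, .ofMul (.of x) = a := QuotientGroup.mk_surjective (Additive.toMul a)
    have h_count : 𝒢.edgeCount x = 1 := ha
    have := DFunLike.congr_fun decomposition (x : 𝒢.PathGroup)
    rw [MonoidHom.mul_apply, MonoidHom.comp_apply _ 𝒢.edgeCount, h_count, map_one, mul_one,
      MonoidHom.comp_apply, map_retraction_coe] at this
    exact ⟨(proj (x : 𝒢.PathGroup)).toAdd, congrArg Additive.ofMul this.symm⟩
  · rintro ⟨b, rfl⟩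
    exact DFunLike.congr_fun h_comp b

theorem exists_H₁_addEquiv_vertexHomology_prod [Finite (Σ v w, 𝒢.E v w)] (v₀ : 𝒢.V) :
    ∃ r : ℕ, Nonempty (𝒢.H₁ v₀ ≃+ 𝒢.VertexHomology × (Fin r → ℤ)) := by
  have : AddGroup.FG (H₁.edgeCount v₀).range := Module.Finite.iff_addGroup_fg.mp <|
    inferInstanceAs (Module.Finite ℤ (AddSubgroup.toIntSubmodule (H₁.edgeCount v₀).range))
  exact exists_addEquiv_prod_of_exact (VertexHomology.toH₁_injective v₀) (exact_toH₁_edgeCount v₀)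

/-! ### Gluing regular covers -/

theorem exists_bijective_sigma_quotient {G F E : Type*} [Group G] {N : Subgroup G} [N.Normal]
    {K : E → Type*} [∀ e, Group (K e)] {φ : ∀ e, K e →* G} (hφ : ∀ e, (φ e).range ≤ N)
    {π : F → E} {δ : F → G} (hδ : Function.Bijective fun f ↦ (π f, (δ f : G ⧸ N)))
    {ψ : ∀ f, K (π f) →* N} (hψ : ∀ f x, (ψ f x : G) = δ f * φ (π f) x * (δ f)⁻¹) :
    ∃ Φ : (Σ f, N ⧸ (ψ f).range) → Σ e, G ⧸ (φ e).range,
      (∀ f (h : N), Φ ⟨f, h⟩ = ⟨π f, QuotientGroup.mk (h * δ f)⟩) ∧ Function.Bijective Φ := by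
  have coset_eq_iff (f : F) (h h' : N) :
      (QuotientGroup.mk (h * δ f) : G ⧸ (φ (π f)).range) = QuotientGroup.mk (h' * δ f) ↔
        (h : N ⧸ (ψ f).range) = h' := by
    rw [QuotientGroup.eq, QuotientGroup.eq, MonoidHom.mem_range, MonoidHom.mem_range]
    refine exists_congr fun x ↦ ?_
    rw [← Subtype.coe_inj, hψ, mul_inv_eq_iff_eq_mul, Subgroup.coe_mul, Subgroup.coe_inv,
      mul_inv_rev, mul_assoc, mul_assoc, eq_inv_mul_iff_mul_eq]
  have mk_mul (h : N) (g : G) : ((h * g : G) : G ⧸ N) = g := by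
    rw [QuotientGroup.mk_mul, (QuotientGroup.eq_one_iff _).mpr h.2, one_mul]
  let toProd (y : Σ e, G ⧸ (φ e).range) : E × G ⧸ N :=
    (y.1, Subgroup.quotientMapOfLE (hφ y.1) y.2)
  refine ⟨fun y ↦ ⟨π y.1, Quotient.liftOn' y.2 (fun h ↦ QuotientGroup.mk (h * δ y.1))
    fun h h' hh ↦ (coset_eq_iff _ h h').mpr (Quotient.sound' hh)⟩, fun _ _ ↦ rfl, ?_, ?_⟩
  · rintro ⟨f, ⟨h⟩⟩ ⟨f', ⟨h'⟩⟩ heq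
    have : (π f, ((h * δ f : G) : G ⧸ N)) = (π f', ((h' * δ f' : G) : G ⧸ N)) :=
      congrArg toProd heq
    rw [mk_mul, mk_mul] at this
    obtain rfl := hδ.1 this
    exact congrArg (Sigma.mk f) ((coset_eq_iff f h h').mp (eq_of_heq (Sigma.mk.inj heq).2))
  · rintro ⟨e, ⟨g⟩⟩
    obtain ⟨f, hf⟩ := hδ.2 (e, g)
    obtain ⟨rfl, hg⟩ := Prod.mk.inj hf
    have : g * (δ f)⁻¹ ∈ N := by
      rw [← QuotientGroup.eq_one_iff, QuotientGroup.mk_mul, QuotientGroup.mk_inv, hg,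
        mul_inv_cancel]
    exact ⟨⟨f, ((⟨g * (δ f)⁻¹, this⟩ : N) : N ⧸ (ψ f).range)⟩,
      congrArg (Sigma.mk (π f)) (congrArg QuotientGroup.mk (inv_mul_cancel_right g (δ f)))⟩

/-- A recipe for gluing a covering of `ℬ` from regular covers of its vertex spaces, the vertices of
`ℬ` being parametrized by `p : X → ℬ.V`. The vertices over `p x` are the copies `Copy x` of the
cover with group `H x`. The edges over `e` are the elements of `Lift e`, and each of them carries
the group of `e`; the bijectivity conditions say that every elevation of an edge map to a copy is
the end of exactly one of them. -/
structure RegularGluing (ℬ : GraphOfGroups.{u}) {X : Type} (p : X → ℬ.V) where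
  bijective : Function.Bijective p
  H : ∀ x, Subgroup (ℬ.VG (p x))
  [normal : ∀ x, (H x).Normal]
  Copy : X → Type u
  Lift : ∀ {x y : X}, ℬ.E (p x) (p y) → Type u
  source : ∀ {x y : X} {e : ℬ.E (p x) (p y)}, Lift e → Copy x
  target : ∀ {x y : X} {e : ℬ.E (p x) (p y)}, Lift e → Copy y
  δι : ∀ {x y : X} {e : ℬ.E (p x) (p y)}, Lift e → ℬ.VG (p x)
  δτ : ∀ {x y : X} {e : ℬ.E (p x) (p y)}, Lift e → ℬ.VG (p y)
  range_φι_le : ∀ {x y : X} (e : ℬ.E (p x) (p y)), (ℬ.φι e).range ≤ H x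
  range_φτ_le : ∀ {x y : X} (e : ℬ.E (p x) (p y)), (ℬ.φτ e).range ≤ H y
  bijective_ι : ∀ {x y : X} (e : ℬ.E (p x) (p y)),
    Function.Bijective fun l : Lift e ↦ (source l, (δι l : ℬ.VG (p x) ⧸ H x))
  bijective_τ : ∀ {x y : X} (e : ℬ.E (p x) (p y)),
    Function.Bijective fun l : Lift e ↦ (target l, (δτ l : ℬ.VG (p y) ⧸ H y))
  nonempty : Nonempty (Σ x, Copy x)
  connected : ∀ a b : Σ x, Copy x, Relation.EqvGen
    (fun a b ↦ ∃ (e : ℬ.E (p a.1) (p b.1)) (l : Lift e), source l = a.2 ∧ target l = b.2) a b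

namespace RegularGluing

attribute [instance] normal

variable {ℬ : GraphOfGroups.{u}} {X : Type} {p : X → ℬ.V} (D : RegularGluing ℬ p)

/-- The edges of the glued graph of groups: lifts of edges of `ℬ` with the given end points. -/
abbrev Edge (a b : Σ x, D.Copy x) : Type u :=
  Σ e : ℬ.E (p a.1) (p b.1), {l : D.Lift e // D.source l = a.2 ∧ D.target l = b.2}

/-- The graph of groups glued according to `D`. -/
def total : GraphOfGroups.{u} where
  V := Σ x, D.Copy x
  E := D.Edge
  nonempty := D.nonempty
  connected a b := (D.connected a b).mono fun _ _ ⟨e, l, h⟩ ↦ ⟨e, l, h⟩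
  VG a := D.H a.1
  EG f := ℬ.EG f.1
  φι f := ((MulAut.conj (D.δι f.2.1)).toMonoidHom.comp (ℬ.φι f.1)).codRestrict _ fun x ↦
    (D.normal _).conj_mem _ (D.range_φι_le f.1 ⟨x, rfl⟩) _
  φτ f := ((MulAut.conj (D.δτ f.2.1)).toMonoidHom.comp (ℬ.φτ f.1)).codRestrict _ fun x ↦
    (D.normal _).conj_mem _ (D.range_φτ_le f.1 ⟨x, rfl⟩) _
  φι_injective f := (MonoidHom.injective_codRestrict _ _ _).mpr <|
    (MulAut.conj _).injective.comp (ℬ.φι_injective f.1)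
  φτ_injective f := (MonoidHom.injective_codRestrict _ _ _).mpr <|
    (MulAut.conj _).injective.comp (ℬ.φτ_injective f.1)

theorem bijective_edges_source (a : Σ x, D.Copy x) :
    Function.Bijective fun f : Σ b, D.Edge a b ↦
      ((⟨p f.1.1, f.2.1⟩ : Σ w, ℬ.E (p a.1) w), (D.δι f.2.2.1 : ℬ.VG (p a.1) ⧸ D.H a.1)) := by
  constructor
  · rintro ⟨⟨y, j⟩, e, l, hl, hj⟩ ⟨⟨y', j'⟩, e', l', hl', hj'⟩ h
    dsimp only at e l hj e' l' hj'
    subst hj hj'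
    obtain ⟨hπ, hδ⟩ := Prod.mk.inj h
    obtain rfl := D.bijective.1 (congrArg Sigma.fst hπ)
    obtain rfl : e = e' := eq_of_heq (Sigma.mk.inj hπ).2
    obtain rfl : l = l' := (D.bijective_ι e).1 (Prod.ext (hl.trans hl'.symm) hδ)
    rfl
  · rintro ⟨⟨w, e⟩, q⟩
    obtain ⟨y, rfl⟩ := D.bijective.2 w
    obtain ⟨l, hl⟩ := (D.bijective_ι e).2 (a.2, q)
    exact ⟨⟨⟨y, D.target l⟩, e, l, congrArg Prod.fst hl, rfl⟩,
      Prod.ext rfl (congrArg (fun q ↦ q.2) hl)⟩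

theorem bijective_edges_target (b : Σ x, D.Copy x) :
    Function.Bijective fun f : Σ a, D.Edge a b ↦
      ((⟨p f.1.1, f.2.1⟩ : Σ w, ℬ.E w (p b.1)), (D.δτ f.2.2.1 : ℬ.VG (p b.1) ⧸ D.H b.1)) := by
  constructor
  · rintro ⟨⟨x, i⟩, e, l, hi, hl⟩ ⟨⟨x', i'⟩, e', l', hi', hl'⟩ h
    dsimp only at e l hi e' l' hi'
    subst hi hi'
    obtain ⟨hπ, hδ⟩ := Prod.mk.inj h
    obtain rfl := D.bijective.1 (congrArg Sigma.fst hπ)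
    obtain rfl : e = e' := eq_of_heq (Sigma.mk.inj hπ).2
    obtain rfl : l = l' := (D.bijective_τ e).1 (Prod.ext (hl.trans hl'.symm) hδ)
    rfl
  · rintro ⟨⟨w, e⟩, q⟩
    obtain ⟨x, rfl⟩ := D.bijective.2 w
    obtain ⟨l, hl⟩ := (D.bijective_τ e).2 (b.2, q)
    exact ⟨⟨⟨x, D.source l⟩, e, l, rfl, congrArg Prod.fst hl⟩,
      Prod.ext rfl (congrArg (fun q ↦ q.2) hl)⟩

/-- The projection of the glued graph of groups to `ℬ`. -/
def covering : Covering D.total ℬ where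
  onV a := p a.1
  onE f := f.1
  onVG a := (D.H a.1).subtype
  onEG f := .id _
  onVG_injective _ := Subtype.val_injective
  onEG_injective _ := Function.injective_id
  δι f := D.δι f.2.1
  δτ f := D.δτ f.2.1
  comm_ι _ _ := rfl
  comm_τ _ _ := rfl
  bijective_ι a := by
    have range_le (e : Σ w, ℬ.E (p a.1) w) : (ℬ.φι e.2).range ≤ D.H a.1 := by
      obtain ⟨w, e⟩ := e
      obtain ⟨y, rfl⟩ := D.bijective.2 w
      exact D.range_φι_le e
    obtain ⟨Φ, hΦ, h_bijective⟩ := exists_bijective_sigma_quotient range_le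
      (D.bijective_edges_source a) (ψ := fun f ↦ D.total.φι f.2) fun _ _ ↦ rfl
    exact ⟨Φ, fun w f h ↦ hΦ ⟨w, f⟩ h, h_bijective⟩
  bijective_τ b := by
    have range_le (e : Σ w, ℬ.E w (p b.1)) : (ℬ.φτ e.2).range ≤ D.H b.1 := by
      obtain ⟨w, e⟩ := e
      obtain ⟨x, rfl⟩ := D.bijective.2 w
      exact D.range_φτ_le e
    obtain ⟨Φ, hΦ, h_bijective⟩ := exists_bijective_sigma_quotient range_le
      (D.bijective_edges_target b) (ψ := fun f ↦ D.total.φτ f.2) fun _ _ ↦ rfl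
    exact ⟨Φ, fun w f h ↦ hΦ ⟨w, f⟩ h, h_bijective⟩

theorem covering_isFinite [∀ x, Finite (D.Copy x)] (h_index : ∀ x, (D.H x).FiniteIndex) :
    D.covering.IsFinite := by
  refine ⟨fun v ↦ ?_, fun a ↦ ?_⟩
  · obtain ⟨x, rfl⟩ := D.bijective.2 v
    refine Finite.of_surjective (β := {a : Σ x, D.Copy x // p a.1 = p x})
      (fun i : D.Copy x ↦ ⟨⟨x, i⟩, rfl⟩) ?_
    rintro ⟨⟨y, i⟩, h⟩
    obtain rfl := D.bijective.1 h
    exact ⟨i, rfl⟩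
  · rw [show (D.covering.onVG a).range = D.H a.1 from (D.H a.1).range_subtype]
    exact h_index a.1

end RegularGluing

end GraphOfGroups

/-! ### Branched surfaces -/

theorem bijective_prod_coe_quotient_ker {G Q L M : Type*} [Group G] [Group Q] {χ : G →* Q}
    (e : L ≃ M × Q) {δ : L → G} {c : Q} (hδ : ∀ l, χ (δ l) = (e l).2 * c) :
    Function.Bijective fun l ↦ ((e l).1, (δ l : G ⧸ χ.ker)) := by
  have coset_eq_iff (x y : G) : (x : G ⧸ χ.ker) = y ↔ χ x = χ y := by
    rw [QuotientGroup.eq, MonoidHom.mem_ker, map_mul, map_inv, inv_mul_eq_one]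
  constructor
  · intro l l' h
    obtain ⟨h_fst, h_snd⟩ := Prod.mk.inj h
    rw [coset_eq_iff, hδ, hδ, mul_left_inj] at h_snd
    exact e.injective (Prod.ext h_fst h_snd)
  · rintro ⟨m, ⟨x⟩⟩
    refine ⟨e.symm (m, χ x * c⁻¹), Prod.ext (by simp) ((coset_eq_iff _ _).mpr ?_)⟩
    rw [hδ, Equiv.apply_symm_apply, inv_mul_cancel_right]

theorem sum_filter_fst_eq {A L M K : Type*} [AddCommMonoid A] [Fintype L] [Fintype K]
    [DecidableEq M] (e : L ≃ M × K) (f : L → A) (m : M) :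
    ∑ p with (e p).1 = m, f p = ∑ k, f (e.symm (m, k)) := by
  refine Finset.sum_nbij' (fun p ↦ (e p).2) (fun k ↦ e.symm (m, k)) (by simp) (by simp) ?_
    (by simp) ?_
  all_goals
    rintro p hp
    obtain rfl := (Finset.mem_filter.mp hp).2
    simp

/-- The sign with which the boundary components of a surface are glued to the circles. -/
def boundarySign : Fin 2 → ℤ := ![1, -1]

theorem boundarySign_mul_self (j : Fin 2) : boundarySign j * boundarySign j = 1 := by
  fin_cases j <;> rfl

/-- A pattern for gluing three families of `n`-sheeted surfaces, each of them indexed by `M`, along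
circles indexed by `L`: the circle `p` lies on the `m`-th surface of the `i`-th family, in the sheet
`k`, where `place i p = (m, k)`. -/
structure GluingPattern (n : ℕ) (M L : Type*) where
  place : Fin 3 → L ≃ M × ZMod n
  nonempty : Nonempty L
  connected : ∀ p q, Relation.EqvGen (fun p q ↦ ∃ i, (place i p).1 = (place i q).1) p q

namespace StandardBranchedSurface

open GraphOfGroups SurfaceGroup

variable {ℬ : GraphOfGroups.{u}} (S : StandardBranchedSurface ℬ)

instance (i : Fin 3) : NeZero (S.genus i) := ⟨Nat.one_le_iff_ne_zero.mp (S.genus_pos i)⟩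

/-- The vertices of `ℬ`, indexed by surfaces and circles. -/
abbrev vertex : Fin 3 ⊕ Fin 2 → ℬ.V := Sum.elim S.surf S.cyc

@[elab_as_elim]
theorem edge_cases {motive : ∀ x y, ℬ.E (S.vertex x) (S.vertex y) → Prop}
    (edge : ∀ i j, motive (.inl i) (.inr j) (S.edge i j)) {x y : Fin 3 ⊕ Fin 2}
    (e : ℬ.E (S.vertex x) (S.vertex y)) : motive x y e :=
  match x, y, e with
  | .inl i, .inr j, e => S.edge_unique i j e ▸ edge i j
  | .inl i, .inl i', e => (S.no_edge_surf i i').elim e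
  | .inr j, _, e => (S.no_edge_cyc j _).elim e

instance finite_edges (x y : Fin 3 ⊕ Fin 2) : Finite (ℬ.E (S.vertex x) (S.vertex y)) :=
  @Finite.of_subsingleton _ <| match x, y with
  | .inl i, .inr j => ⟨fun e e' ↦ (S.edge_unique i j e).trans (S.edge_unique i j e').symm⟩
  | .inl i, .inl i' => ⟨(S.no_edge_surf i i').elim⟩
  | .inr j, _ => ⟨(S.no_edge_cyc j _).elim⟩

/-- The generator of an edge group which is mapped to the generator of the circle. -/
noncomputable def edgeGenerator (i : Fin 3) (j : Fin 2) : ℬ.EG (S.edge i j) :=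
  (MulEquiv.ofBijective _ (S.φτ_bijective i j)).symm (S.circle j (.ofAdd 1))

theorem φτ_edgeGenerator (i : Fin 3) (j : Fin 2) :
    ℬ.φτ (S.edge i j) (S.edgeGenerator i j) = S.circle j (.ofAdd 1) :=
  (MulEquiv.ofBijective _ (S.φτ_bijective i j)).apply_symm_apply _

theorem circle_hom_ext {j : Fin 2} {G : Type*} [Group G] {φ ψ : ℬ.VG (S.cyc j) →* G}
    (h : φ (S.circle j (.ofAdd 1)) = ψ (S.circle j (.ofAdd 1))) : φ = ψ := by
  ext x
  obtain ⟨z, rfl⟩ := (S.circle j).surjective x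
  exact DFunLike.congr_fun (MonoidHom.ext_mint (f := φ.comp (S.circle j).toMonoidHom)
    (g := ψ.comp (S.circle j).toMonoidHom) h) z

theorem edge_hom_ext {i : Fin 3} {j : Fin 2} {G : Type*} [Group G]
    {φ ψ : ℬ.EG (S.edge i j) →* G} (h : φ (S.edgeGenerator i j) = ψ (S.edgeGenerator i j)) :
    φ = ψ := by
  let τ := MulEquiv.ofBijective _ (S.φτ_bijective i j)
  have : φ.comp τ.symm.toMonoidHom = ψ.comp τ.symm.toMonoidHom := S.circle_hom_ext h
  ext x
  simpa using DFunLike.congr_fun this (τ x)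

theorem isConj_surface_φι (i : Fin 3) (j : Fin 2) :
    IsConj (S.surface i (ℬ.φι (S.edge i j) (S.edgeGenerator i j)))
      (boundary j ^ boundarySign j) := by
  match j with
  | 0 => simpa [boundarySign] using S.attach_zero i _ (S.φτ_edgeGenerator i 0)
  | 1 => simpa [boundarySign] using S.attach_one i _ (S.φτ_edgeGenerator i 1)

/-- An element of the surface group conjugating the attaching map of a boundary component to the
standard boundary loop. -/
noncomputable def conjugator (i : Fin 3) (j : Fin 2) : SurfaceGroup (S.genus i) 2 :=
  (isConj_iff.mp (S.isConj_surface_φι i j)).choose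

theorem conjugator_mul_surface_φι (i : Fin 3) (j : Fin 2) :
    S.conjugator i j * S.surface i (ℬ.φι (S.edge i j) (S.edgeGenerator i j)) *
      (S.conjugator i j)⁻¹ = boundary j ^ boundarySign j :=
  (isConj_iff.mp (S.isConj_surface_φι i j)).choose_spec

/-- The character `handleChar` of a surface vertex group. -/
noncomputable def surfaceChar (n : ℕ) (i : Fin 3) :
    ℬ.VG (S.surf i) →* Multiplicative (ZMod n) :=
  (handleChar (S.genus i) 2 n).comp (S.surface i).toMonoidHom

theorem surfaceChar_φι (n : ℕ) (i : Fin 3) (j : Fin 2) (x : ℬ.EG (S.edge i j)) :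
    S.surfaceChar n i (ℬ.φι (S.edge i j) x) = 1 := by
  refine DFunLike.congr_fun (f := (S.surfaceChar n i).comp (ℬ.φι (S.edge i j))) (g := 1)
    (S.edge_hom_ext ?_) x
  have h := congrArg (handleChar (S.genus i) 2 n) (S.conjugator_mul_surface_φι i j)
  rwa [map_mul, map_mul, map_inv, mul_inv_cancel_comm, map_zpow,
    show boundary j = (PuncturedGen.c j).elt from rfl, handleChar_elt, one_zpow] at h

/-- The isomorphism of the kernel of `surfaceChar` with the cyclic cover of the surface group. -/
noncomputable def kerSurfaceCharEquiv (n : ℕ) (i : Fin 3) :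
    (S.surfaceChar n i).ker ≃* CyclicCover (S.genus i) 2 n :=
  .ofBijective ((S.surface i).toMonoidHom.subgroupComap (CyclicCover (S.genus i) 2 n))
    ⟨fun _ _ h ↦ Subtype.ext ((S.surface i).injective (congrArg Subtype.val h)),
      MonoidHom.subgroupComap_surjective_of_surjective _ _ (S.surface i).surjective⟩

section cyclicGluing

variable {n : ℕ} {M L : Type u}

/-- The subgroups of the vertex groups corresponding to the covers that are glued. -/
noncomputable def coverGroup (n : ℕ) : ∀ x, Subgroup (ℬ.VG (S.vertex x))
  | .inl i => (S.surfaceChar n i).ker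
  | .inr _ => ⊤

/-- The sets indexing the copies of the covers: `M` for surfaces and `L` for circles. -/
abbrev CoverIndex (M L : Type u) : Fin 3 ⊕ Fin 2 → Type u
  | .inl _ => M
  | .inr _ => L

/-- The copies which contain the circle with index `l`. -/
def copyOf (I : GluingPattern n M L) (l : L) : ∀ x, CoverIndex M L x
  | .inl i => (I.place i l).1
  | .inr _ => l

/-- The conjugating elements, which move the lifts of a boundary component to the different sheets
of the cyclic cover. -/
noncomputable def sheetShift (I : GluingPattern n M L) (l : L) :
    ∀ x _ : Fin 3 ⊕ Fin 2, ℬ.VG (S.vertex x)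
  | .inl i, .inr j => (S.surface i).symm
      (handle (S.genus i) 2 ^ ((I.place i l).2.cast : ℤ) * S.conjugator i j)
  | _, _ => 1

theorem surfaceChar_sheetShift (I : GluingPattern n M L) (l : L) (i : Fin 3) (j : Fin 2) :
    S.surfaceChar n i (S.sheetShift I l (.inl i) (.inr j)) =
      .ofAdd (I.place i l).2 * handleChar _ 2 n (S.conjugator i j) := by
  refine (congrArg (handleChar _ 2 n) ((S.surface i).apply_symm_apply _)).trans ?_
  rw [map_mul, map_zpow, handleChar_handle, ← ofAdd_zsmul, zsmul_one, ZMod.intCast_zmod_cast]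

theorem eqvGen_copyOf (I : GluingPattern n M L) (a b : Σ x, CoverIndex M L x) :
    Relation.EqvGen (fun a b ↦ ∃ (_ : ℬ.E (S.vertex a.1) (S.vertex b.1)) (l : L),
      copyOf I l a.1 = a.2 ∧ copyOf I l b.1 = b.2) a b := by
  set r := Relation.EqvGen (fun a b : Σ x, CoverIndex M L x ↦
    ∃ (_ : ℬ.E (S.vertex a.1) (S.vertex b.1)) (l : L),
      copyOf I l a.1 = a.2 ∧ copyOf I l b.1 = b.2)
  have equivalence : Equivalence r := Relation.EqvGen.is_equivalence _
  have edge (i j l) : r ⟨.inl i, (I.place i l).1⟩ ⟨.inr j, l⟩ :=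
    .rel _ _ ⟨S.edge i j, l, rfl, rfl⟩
  have circles (p q : L) : r ⟨.inr 0, p⟩ ⟨.inr 0, q⟩ := by
    induction I.connected p q with
    | rel p q h =>
      obtain ⟨i, hi⟩ := h
      exact equivalence.trans (equivalence.symm (hi ▸ edge i 0 p)) (edge i 0 q)
    | refl p => exact equivalence.refl _
    | symm p q _ ih => exact equivalence.symm ih
    | trans p q s _ _ ih ih' => exact equivalence.trans ih ih'
  have exists_circle : ∀ a, ∃ p : L, r a ⟨.inr 0, p⟩
    | ⟨.inl i, m⟩ => by
      obtain ⟨⟨p, hp⟩⟩ : Nonempty {p // (I.place i p).1 = m} := ⟨(I.place i).symm (m, 0), by simp⟩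
      exact ⟨p, hp ▸ edge i 0 p⟩
    | ⟨.inr j, p⟩ => ⟨p, equivalence.trans (equivalence.symm (edge 0 j p)) (edge 0 0 p)⟩
  obtain ⟨p, hp⟩ := exists_circle a
  obtain ⟨q, hq⟩ := exists_circle b
  exact equivalence.trans hp (equivalence.trans (circles p q) (equivalence.symm hq))

/-- The gluing of copies of the `n`-sheeted cyclic covers of the surfaces, indexed by `M`, along
trivial covers of the circles, indexed by `L`: the boundary component in the sheet `k` of the `m`-th
copy of the `i`-th surface is glued to the circle `(I.place i).symm (m, k)`. -/
noncomputable def cyclicGluing (I : GluingPattern n M L) :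
    RegularGluing ℬ S.vertex where
  bijective := S.vertices
  H := S.coverGroup n
  normal
    | .inl _ => MonoidHom.normal_ker _
    | .inr _ => inferInstanceAs (⊤ : Subgroup _).Normal
  Copy := CoverIndex M L
  Lift _ := L
  source l := copyOf I l _
  target l := copyOf I l _
  δι {x y _} l := S.sheetShift I l x y
  δτ _ := 1
  range_φι_le e := by
    induction e using S.edge_cases with
    | edge i j =>
      rintro _ ⟨x, rfl⟩
      exact S.surfaceChar_φι n i j x
  range_φτ_le e := by
    induction e using S.edge_cases with
    | edge i j => exact le_top
  bijective_ι e := by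
    induction e using S.edge_cases with
    | edge i j =>
      exact bijective_prod_coe_quotient_ker
        ((I.place i).trans (.prodCongr (.refl M) Multiplicative.ofAdd))
        fun l ↦ S.surfaceChar_sheetShift I l i j
  bijective_τ e := by
    induction e using S.edge_cases with
    | edge _ j =>
      have : Subsingleton (ℬ.VG (S.vertex (.inr j)) ⧸ S.coverGroup n (.inr j)) :=
        QuotientGroup.subsingleton_quotient_top
      exact ⟨fun l l' h ↦ congrArg Prod.fst h,
        fun q ↦ ⟨q.1, Prod.ext rfl (Subsingleton.elim _ _)⟩⟩
  nonempty := I.nonempty.map fun p ↦ ⟨.inr 0, p⟩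
  connected := S.eqvGen_copyOf I

end cyclicGluing

variable {n : ℕ} {M L : Type u} (I : GluingPattern n M L)

/-- The total space of `cyclicGluing`. -/
noncomputable abbrev cyclicCover : GraphOfGroups.{u} := (S.cyclicGluing I).total

/-- The vertex of the cover given by the `m`-th copy of the cover of the `i`-th surface. -/
def surfaceVertex (i : Fin 3) (m : M) : (S.cyclicCover I).V := ⟨.inl i, m⟩

/-- The vertex of the cover given by the `p`-th copy of the `j`-th circle. -/
def circleVertex (j : Fin 2) (p : L) : (S.cyclicCover I).V := ⟨.inr j, p⟩

@[elab_as_elim]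
theorem cyclicCover_vertex_cases {motive : (S.cyclicCover I).V → Prop}
    (surfaceVertex : ∀ i m, motive (S.surfaceVertex I i m))
    (circleVertex : ∀ j p, motive (S.circleVertex I j p)) :
    ∀ v, motive v
  | ⟨.inl i, m⟩ => surfaceVertex i m
  | ⟨.inr j, p⟩ => circleVertex j p

/-- The edge of the cover along which the circle `p` over `j` is glued to a surface over `i`. -/
noncomputable def boundaryEdge (i : Fin 3) (j : Fin 2) (p : L) :
    (S.cyclicCover I).E (S.surfaceVertex I i (I.place i p).1)
      (S.circleVertex I j p) :=
  ⟨S.edge i j, p, rfl, rfl⟩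

@[elab_as_elim]
theorem cyclicCover_edge_cases {motive : ∀ v w, (S.cyclicCover I).E v w → Prop}
    (boundaryEdge : ∀ i j p, motive _ _ (S.boundaryEdge I i j p))
    {v w : (S.cyclicCover I).V} (f : (S.cyclicCover I).E v w) :
    motive v w f := by
  have of_edge {x y} (e : ℬ.E (S.vertex x) (S.vertex y)) {a : CoverIndex M L x}
      {b : CoverIndex M L y} (p : L) (h_source : copyOf I p x = a) (h_target : copyOf I p y = b) :
      motive ⟨x, a⟩ ⟨y, b⟩ ⟨e, p, h_source, h_target⟩ := by
    subst h_source h_target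
    induction e using S.edge_cases with
    | edge i j => exact boundaryEdge i j p
  exact of_edge f.1 f.2.1 f.2.2.1 f.2.2.2

/-- The vertex groups over the surfaces are the groups of the cyclic covers. -/
noncomputable def surfaceVertexEquiv (i : Fin 3) (m : M) :
    (S.cyclicCover I).VG (S.surfaceVertex I i m) ≃*
      CyclicCover (S.genus i) 2 n :=
  S.kerSurfaceCharEquiv n i

/-- The vertex groups over the circles are infinite cyclic. -/
noncomputable def circleVertexEquiv (j : Fin 2) (p : L) :
    (S.cyclicCover I).VG (S.circleVertex I j p) ≃*
      Multiplicative ℤ :=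
  (Subgroup.topEquiv (G := ℬ.VG (S.cyc j))).trans (S.circle j).symm

theorem surfaceVertexEquiv_φι_boundaryEdge (i : Fin 3) (j : Fin 2) (p : L) :
    S.surfaceVertexEquiv I i _ ((S.cyclicCover I).φι
      (S.boundaryEdge I i j p) (S.edgeGenerator i j)) =
      CyclicCover.boundaryLift (S.genus i) j (I.place i p).2 ^ boundarySign j := by
  ext1
  let t := handle (S.genus i) 2 ^ ((I.place i p).2.cast : ℤ)
  let x := ℬ.φι (S.edge i j) (S.edgeGenerator i j)
  let c := S.conjugator i j
  have h_conj : c * S.surface i x * c⁻¹ = boundary j ^ boundarySign j :=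
    S.conjugator_mul_surface_φι i j
  calc S.surface i ((S.surface i).symm (t * c) * x * ((S.surface i).symm (t * c))⁻¹)
    _ = t * (c * S.surface i x * c⁻¹) * t⁻¹ := by
      simp only [map_mul, map_inv, MulEquiv.apply_symm_apply, mul_inv_rev, mul_assoc]
    _ = (t * boundary j * t⁻¹) ^ boundarySign j := by rw [h_conj, conj_zpow]

theorem circleVertexEquiv_φτ_boundaryEdge (i : Fin 3) (j : Fin 2) (p : L) :
    S.circleVertexEquiv I j p ((S.cyclicCover I).φτ
      (S.boundaryEdge I i j p) (S.edgeGenerator i j)) = .ofAdd 1 := by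
  change (S.circle j).symm (1 * ℬ.φτ (S.edge i j) (S.edgeGenerator i j) * 1⁻¹) = _
  rw [one_mul, inv_one, mul_one, φτ_edgeGenerator, MulEquiv.symm_apply_apply]

/-- The family of homomorphisms of vertex groups with prescribed values on the groups of the cyclic
covers and on the generators of the circles. -/
noncomputable def vertexHom {B : Type*} [Group B]
    (φ : ∀ i, M → CyclicCover (S.genus i) 2 n →* B) (c : Fin 2 → L → B)
    (v : (S.cyclicCover I).V) : (S.cyclicCover I).VG v →* B :=
  match v with
  | ⟨.inl i, m⟩ => show (S.cyclicCover I).VG (S.surfaceVertex I i m) →* B from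
      (φ i m).comp (S.surfaceVertexEquiv I i m).toMonoidHom
  | ⟨.inr j, p⟩ => show (S.cyclicCover I).VG (S.circleVertex I j p) →* B from
      (zpowersHom B (c j p)).comp (S.circleVertexEquiv I j p).toMonoidHom

theorem vertexHom_φι {B : Type*} [Group B] {φ : ∀ i, M → CyclicCover (S.genus i) 2 n →* B}
    {c : Fin 2 → L → B}
    (h : ∀ i j p, φ i (I.place i p).1 (CyclicCover.boundaryLift _ j (I.place i p).2) =
      c j p ^ boundarySign j)
    (v w : (S.cyclicCover I).V) (e : (S.cyclicCover I).E v w) (x : (S.cyclicCover I).EG e) :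
    S.vertexHom I φ c v ((S.cyclicCover I).φι e x) =
      S.vertexHom I φ c w ((S.cyclicCover I).φτ e x) := by
  induction e using S.cyclicCover_edge_cases I with
  | boundaryEdge i j p =>
    refine DFunLike.congr_fun (f := (S.vertexHom I φ c _).comp
      ((S.cyclicCover I).φι (S.boundaryEdge I i j p))) (g := (S.vertexHom I φ c _).comp
      ((S.cyclicCover I).φτ (S.boundaryEdge I i j p))) (S.edge_hom_ext ?_) x
    calc φ i (I.place i p).1 (S.surfaceVertexEquiv I i _
          ((S.cyclicCover I).φι (S.boundaryEdge I i j p) (S.edgeGenerator i j)))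
      _ = c j p := by
        rw [surfaceVertexEquiv_φι_boundaryEdge, map_zpow, h, ← zpow_mul, boundarySign_mul_self,
          zpow_one]
      _ = zpowersHom B (c j p) (S.circleVertexEquiv I j p
          ((S.cyclicCover I).φτ (S.boundaryEdge I i j p) (S.edgeGenerator i j))) := by
        rw [circleVertexEquiv_φτ_boundaryEdge, zpowersHom_apply, toAdd_ofAdd, zpow_one]

/-- The classes of the elements of the group of the `m`-th cover of the `i`-th surface. -/
noncomputable def surfaceClass (i : Fin 3) (m : M) : CyclicCover (S.genus i) 2 n →*
    Multiplicative (S.cyclicCover I).VertexHomology :=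
  (VertexHomology.vertexClass (S.surfaceVertex I i m)).comp
    (S.surfaceVertexEquiv I i m).symm.toMonoidHom

/-- The class of a circle of the cover. -/
noncomputable def circleClass (j : Fin 2) (p : L) :
    (S.cyclicCover I).VertexHomology :=
  (VertexHomology.vertexClass (S.circleVertex I j p)
    ((S.circleVertexEquiv I j p).symm (.ofAdd 1))).toAdd

theorem surfaceClass_boundaryLift (i : Fin 3) (j : Fin 2) (p : L) :
    (S.surfaceClass I i (I.place i p).1
      (CyclicCover.boundaryLift _ j (I.place i p).2)).toAdd =
      boundarySign j • S.circleClass I j p := by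
  have h := VertexHomology.vertexClass_φι (S.boundaryEdge I i j p)
    (S.edgeGenerator i j)
  rw [(MulEquiv.eq_symm_apply _).mpr (S.circleVertexEquiv_φτ_boundaryEdge I i j p),
    (MulEquiv.eq_symm_apply _).mpr (S.surfaceVertexEquiv_φι_boundaryEdge I i j p),
    map_zpow, map_zpow] at h
  rw [circleClass, ← h, toAdd_zpow, smul_smul, boundarySign_mul_self, one_smul]
  rfl

variable {B : Type*} [AddCommGroup B]

theorem vertexHomology_hom_ext {φ ψ : (S.cyclicCover I).VertexHomology →+ B}
    (h_surface : ∀ i m (x : CyclicCover.FreeGen (S.genus i) n),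
      φ (S.surfaceClass I i m x.elt).toAdd =
        ψ (S.surfaceClass I i m x.elt).toAdd)
    (h_circle : ∀ j p,
      φ (S.circleClass I j p) = ψ (S.circleClass I j p)) :
    φ = ψ := by
  refine VertexHomology.hom_ext fun v x ↦ ?_
  induction v using S.cyclicCover_vertex_cases I with
  | surfaceVertex i m =>
    have h : φ.toMultiplicative.comp (S.surfaceClass I i m) =
        ψ.toMultiplicative.comp (S.surfaceClass I i m) := by
      refine CyclicCover.hom_ext_of_boundary (h_surface i m) fun j k ↦ ?_
      obtain ⟨p, hp⟩ := (I.place i).surjective (m, k)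
      obtain rfl : (I.place i p).1 = m := congrArg Prod.fst hp
      obtain rfl : (I.place i p).2 = k := congrArg Prod.snd hp
      have h_boundary := S.surfaceClass_boundaryLift I i j p
      have : φ (S.surfaceClass I i (I.place i p).1
          (CyclicCover.boundaryLift _ j (I.place i p).2)).toAdd =
          ψ (S.surfaceClass I i (I.place i p).1
          (CyclicCover.boundaryLift _ j (I.place i p).2)).toAdd := by
        rw [h_boundary, map_zsmul, map_zsmul, h_circle]
      exact congrArg Multiplicative.ofAdd this
    have hx := DFunLike.congr_fun h (S.surfaceVertexEquiv I i m x)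
    simpa [surfaceClass] using hx
  | circleVertex j p =>
    let c := S.circleVertexEquiv I j p
    let class_p := VertexHomology.vertexClass (S.circleVertex I j p)
    have h : (φ.toMultiplicative.comp class_p).comp c.symm.toMonoidHom =
        (ψ.toMultiplicative.comp class_p).comp c.symm.toMonoidHom :=
      MonoidHom.ext_mint (h_circle j p)
    have hx := DFunLike.congr_fun h (c x)
    simpa [c] using hx

theorem sum_boundary_circleClass [NeZero n] [Fintype L] [DecidableEq M] (i : Fin 3) (m : M) :
    ∑ p with (I.place i p).1 = m, (S.circleClass I 0 p -
      S.circleClass I 1 p) = 0 := by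
  have h := CyclicCover.prod_map_boundaryLift (S.surfaceClass I i m)
  have h_add := congrArg Multiplicative.toAdd h
  rw [toAdd_prod, toAdd_one] at h_add
  rw [sum_filter_fst_eq]
  refine .trans (Finset.sum_congr rfl fun k _ ↦ ?_) h_add
  obtain ⟨p, hp⟩ := (I.place i).surjective (m, k)
  obtain rfl : (I.place i p).1 = m := congrArg Prod.fst hp
  obtain rfl : (I.place i p).2 = k := congrArg Prod.snd hp
  rw [toAdd_prod, Fin.sum_univ_two, surfaceClass_boundaryLift, surfaceClass_boundaryLift]
  simp [boundarySign, sub_eq_add_neg]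

theorem exists_vertexHomology_hom [NeZero n] [Fintype L] [DecidableEq M]
    (f : ∀ i, M → CyclicCover.FreeGen (S.genus i) n → B) (c : Fin 2 → L → B)
    (hc : ∀ i m, ∑ p with (I.place i p).1 = m, (c 0 p - c 1 p) = 0) :
    ∃ φ : (S.cyclicCover I).VertexHomology →+ B,
      (∀ i m (x : CyclicCover.FreeGen (S.genus i) n),
        φ (S.surfaceClass I i m x.elt).toAdd = f i m x) ∧
      ∀ j p, φ (S.circleClass I j p) = c j p := by
  have exists_hom (i m) : ∃ φ : CyclicCover (S.genus i) 2 n →* Multiplicative B,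
      (∀ x, φ (CyclicCover.FreeGen.elt x) = .ofAdd (f i m x)) ∧
      ∀ j k, φ (CyclicCover.boundaryLift _ j k) =
        .ofAdd (boundarySign j • c j ((I.place i).symm (m, k))) := by
    refine CyclicCover.exists_hom_of_prod_eq_one _ _ ?_
    simp only [← ofAdd_sum, ofAdd_eq_one, Fin.sum_univ_two]
    simpa [boundarySign, sum_filter_fst_eq, sub_eq_add_neg] using hc i m
  choose φ hφ_free hφ_boundary using exists_hom
  refine ⟨VertexHomology.lift (S.vertexHom I φ fun j p ↦ .ofAdd (c j p))
    (S.vertexHom_φι I fun i j p ↦ ?_), fun i m x ↦ ?_, fun j p ↦ ?_⟩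
  · rw [hφ_boundary, Prod.mk.eta, Equiv.symm_apply_apply, ofAdd_zsmul]
  · refine (VertexHomology.lift_vertexClass _ _ _).trans (congrArg Multiplicative.toAdd ?_)
    exact (congrArg (φ i m) ((S.surfaceVertexEquiv I i m).apply_symm_apply _)).trans
      (hφ_free i m x)
  · refine (VertexHomology.lift_vertexClass _ _ _).trans (congrArg Multiplicative.toAdd ?_)
    refine (congrArg (zpowersHom _ (Multiplicative.ofAdd (c j p)))
      ((S.circleVertexEquiv I j p).apply_symm_apply _)).trans ?_
    exact zpow_one _

theorem nonempty_vertexHomology_addEquiv [NeZero n] [Finite L] :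
    Nonempty ((S.cyclicCover I).VertexHomology ≃+
      IncidenceQuotient ℤ (fun i p ↦ (I.place i p).1) ×
        ((Σ i, M × CyclicCover.FreeGen (S.genus i) n) ⊕ L →₀ ℤ)) := by
  classical
  have := Fintype.ofFinite L
  let line (i : Fin 3) (p : L) : M := (I.place i p).1
  let F := (Σ i, M × CyclicCover.FreeGen (S.genus i) n) ⊕ L →₀ ℤ
  obtain ⟨φ, hφ_free, hφ_circle⟩ := S.exists_vertexHomology_hom I
    (B := IncidenceQuotient ℤ line × F) (fun i m x ↦ (0, .single (.inl ⟨i, m, x⟩) 1))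
    ![fun p ↦ (.point line p, .single (.inr p) 1), fun p ↦ (0, .single (.inr p) 1)]
    (fun i m ↦ Prod.ext
      (by simpa [Prod.fst_sum] using IncidenceQuotient.sum_point_eq_zero (line := line) i m)
      (by simp [Prod.snd_sum]))
  let ψQ : IncidenceQuotient ℤ line →+ (S.cyclicCover I).VertexHomology :=
    IncidenceQuotient.lift (fun p ↦ S.circleClass I 0 p - S.circleClass I 1 p)
      (S.sum_boundary_circleClass I)
  let ψF : F →+ (S.cyclicCover I).VertexHomology := Finsupp.liftAddHom <| Sum.elim
    (fun y ↦ zmultiplesHom _ (S.surfaceClass I y.1 y.2.1 y.2.2.elt).toAdd)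
    (fun p ↦ zmultiplesHom _ (S.circleClass I 1 p))
  have hψQ (p) : ψQ (.point line p) = S.circleClass I 0 p - S.circleClass I 1 p :=
    IncidenceQuotient.lift_point _ _ p
  have hψF_inl (y) : ψF (.single (.inl y) 1) = (S.surfaceClass I y.1 y.2.1 y.2.2.elt).toAdd :=
    (Finsupp.liftAddHom_apply_single _ _ _).trans (one_zsmul _)
  have hψF_inr (p) : ψF (.single (.inr p) 1) = S.circleClass I 1 p :=
    (Finsupp.liftAddHom_apply_single _ _ _).trans (one_zsmul _)
  have hφ_ψQ : φ.comp ψQ = .inl _ _ := IncidenceQuotient.hom_ext fun p ↦ by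
    simp [hψQ, hφ_circle]
  have hφ_ψF : φ.comp ψF = .inr _ _ := Finsupp.addHom_ext' fun y ↦ AddMonoidHom.ext_int <| by
    rcases y with ⟨i, m, x⟩ | p
    · exact (congrArg φ (hψF_inl _)).trans (hφ_free i m x)
    · exact (congrArg φ (hψF_inr p)).trans (hφ_circle 1 p)
  refine ⟨φ.toAddEquiv (ψQ.coprod ψF)
    (S.vertexHomology_hom_ext I (fun i m x ↦ ?_) fun j p ↦ ?_) ?_⟩
  · simp [hφ_free, hψF_inl]
  · fin_cases j <;> simp [hφ_circle, hψQ, hψF_inr]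
  · rw [AddMonoidHom.comp_coprod, hφ_ψQ, hφ_ψF, AddMonoidHom.coprod_inl_inr]

theorem finite_coverIndex [Finite M] [Finite L] : ∀ x, Finite (CoverIndex M L x)
  | .inl _ => ‹Finite M›
  | .inr _ => ‹Finite L›

theorem finiteIndex_coverGroup [NeZero n] : ∀ x, (S.coverGroup n x).FiniteIndex
  | .inl i => Subgroup.finiteIndex_ker (S.surfaceChar n i)
  | .inr _ => inferInstanceAs (⊤ : Subgroup _).FiniteIndex

theorem isFinite_covering_cyclicGluing [NeZero n] [Finite M] [Finite L] :
    (S.cyclicGluing I).covering.IsFinite :=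
  have : ∀ x, Finite ((S.cyclicGluing I).Copy x) := finite_coverIndex
  (S.cyclicGluing I).covering_isFinite S.finiteIndex_coverGroup

theorem exists_H₁_cyclicCover_addEquiv [NeZero n] [Finite M] [Finite L]
    (v₀ : (S.cyclicCover I).V) :
    ∃ r : ℕ, Nonempty ((S.cyclicCover I).H₁ v₀ ≃+
      IncidenceQuotient ℤ (fun i p ↦ (I.place i p).1) × (Fin r → ℤ)) := by
  have finite_edges (v w) : Finite ((S.cyclicCover I).E v w) :=
    inferInstanceAs (Finite (Σ _ : ℬ.E (S.vertex v.1) (S.vertex w.1), {l : L // _}))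
  have := finite_coverIndex (M := M) (L := L)
  have finite_vertices : Finite (S.cyclicCover I).V :=
    inferInstanceAs (Finite (Σ x, CoverIndex M L x))
  obtain ⟨e⟩ := S.nonempty_vertexHomology_addEquiv I
  let X := (Σ i, M × CyclicCover.FreeGen (S.genus i) n) ⊕ L
  let coords : (X →₀ ℤ) ≃+ (Fin (Nat.card X) → ℤ) :=
    ((Finsupp.linearEquivFunOnFinite ℤ ℤ X).trans
      (LinearEquiv.funCongrLeft ℤ ℤ (Finite.equivFin X).symm)).toAddEquiv
  exact exists_addEquiv_prod_trans (exists_H₁_addEquiv_vertexHomology_prod v₀)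
    ⟨Nat.card X, ⟨e.trans ((AddEquiv.refl _).prodCongr coords)⟩⟩

end StandardBranchedSurface

/-- The gluing pattern on the addition table of `M`, whose cells are the circles: the rows, the
columns and the symbols of this Latin square give the three families of surfaces, and the sheet of a
cell is its position in its row, column or symbol. -/
def latinPattern {M : Type*} [AddCommGroup M] {n : ℕ} (e : M ≃ ZMod n) :
    GluingPattern n M (M × M) where
  place i :=
    { toFun := fun p ↦ (latinLine i p, e (![p.2, p.1, p.1] i))
      invFun := fun q ↦
        ![(q.1, e.symm q.2), (e.symm q.2, q.1), (e.symm q.2, q.1 - e.symm q.2)] i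
      left_inv := fun p ↦ by fin_cases i <;> simp [latinLine]
      right_inv := fun q ↦ by fin_cases i <;> simp [latinLine] }
  nonempty := ⟨0⟩
  connected p q := .trans p (p.1, q.2) q (.rel _ _ ⟨0, rfl⟩) (.rel _ _ ⟨1, rfl⟩)

theorem mainTheorem5 (ℬ : GraphOfGroups.{u}) (hℬ : ℬ.IsStandardBranchedSurface)
    (M : Type*) [AddCommGroup M] [Finite M] :
    ∃ (ℬM : GraphOfGroups.{u}) (Φ : GraphOfGroups.Covering ℬM ℬ) (r : ℕ),
      Φ.IsFinite ∧ ∀ v₀ : ℬM.V, Nonempty (ℬM.H₁ v₀ ≃+ M × (Fin r → ℤ)) := by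
  obtain ⟨S⟩ := hℬ
  let N := Shrink.{u} M
  have : NeZero (Nat.card N) := ⟨Nat.card_pos.ne'⟩
  obtain ⟨e⟩ : Nonempty (N ≃ ZMod (Nat.card N)) := Finite.card_eq.mp (Nat.card_zmod _).symm
  let ℬM := S.cyclicCover (latinPattern e)
  obtain ⟨u₀⟩ := ℬM.nonempty
  obtain ⟨r, ⟨f⟩⟩ : ∃ r : ℕ, Nonempty (ℬM.H₁ u₀ ≃+ N × (Fin r → ℤ)) :=
    exists_addEquiv_prod_trans (S.exists_H₁_cyclicCover_addEquiv (latinPattern e) u₀)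
      (IncidenceQuotient.exists_addEquiv_prod_of_latinLine N)
  refine ⟨ℬM, (S.cyclicGluing (latinPattern e)).covering, r,
    S.isFinite_covering_cyclicGluing _, fun v₀ ↦ ?_⟩
  obtain ⟨g⟩ := GraphOfGroups.nonempty_H₁_addEquiv v₀ u₀
  exact ⟨(g.trans f).trans (Shrink.addEquiv.prodCongr (.refl _))⟩
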